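/- \textbf{Theorem (Optimistic quantum Fourier transform).} Conventions. Basis states of an $n$-qubit register are bit strings $x=(x_0,\dots,x_{n-1})$; for a bit string of length $\ell$ put $X(x)=\sum_k x_k2^{\ell-1-k}$ (first qubit most significant) and $Y(x)=\sum_k x_k2^{k}$ (first qubit least significant). $\mathrm{QFT}_{2^\ell}$ is the unitary $|x\rangle\mapsto 2^{-\ell/2}\sum_{y}e^{2\pi i X(x)Y(y)/2^\ell}|y\rangle$ on $\ell$ qubits. For a block size $m\ge1$, divide the $n$ qubits into consecutive blocks $0,1,\dots,\lceil n/m\rceil-1$ of $m$ qubits each (the last one is shorter if $m\nmid n$; a QFT on it is the QFT of its size). Write $X_i$, $Y_i$ for the values $X$, $Y$ of the bit string on block $i$. The phase rotation between blocks $i$ and $i+1$ is the diagonal operator multiplying each basis state by $\exp(2\pi i\,X_{i+1}Y_i/2^{m_i+m_{i+1}})$, where $m_j$ is the size of block $j$ (so the denominator is $2^{2m}$ for full blocks). The optimistic QFT with block size $m$ is the block circuit of the following five steps; it uses only block QFTs, their inverses, and phase rotations between neighbouring blocks: (1) the QFT on each even-indexed block; (2) the phase rotation between blocks $i$ and $i+1$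 for each even $i$ (with $i+1$ a block); (3) the QFT on each odd-indexed block and the inverse QFT on each even-indexed block; (4) the phase rotation between blocks $i$ and $i+1$ for each odd $i$ (with $i+1$ a block); (5) the QFT on each even-indexed block. There are constants $C,K>0$ such that for every integer $n\ge1$ and every real $\epsilon>0$ with $2\epsilon\le n$, the block size $m=\lceil C\ln(n/\epsilon)\rceil$ satisfies $1\le m\le K\ln(n/\epsilon)$, and the following hold for the optimistic QFT with block size $m$. (a) In each of the five steps the gates act on pairwise disjoint sets of blocks. (b) It is an optimistic circuit for $\mathrm{QFT}_{2^n}$ with error $\epsilon$: the operator $\widetilde U$ it induces and $\mathrm{QFT}_{2^n}$ are unitary, and $$\frac1{2^n}\,\bigl\|\widetilde U-\mathrm{QFT}_{2^n}\bigr\|_F^2\le\epsilon,\qquad \|E\|_F^2=\mathrm{Tr}(E^\dagger E).$$ (c) Its five steps are implemented exactly by five successive circuits of Hadamard and two-qubit controlled-phase gates $\mathrm{diag}(1,1,1,e^{i\theta})$ ($\theta\in\mathbb R$) on the same $n$ qubits, without ancillas or measurements, of total depth at most $K\ln(n/\epsilon)$, where depth is the number of layers of gates on pairwise disjoint qubits;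 each of these gates acts inside a single block or inside two neighbouring blocks. -/

import Mathlib

open scoped Matrix

noncomputable section

namespace OptimisticQFT

/-- Computational basis states of `n` qubits; qubit `0` comes first. -/
abbrev Basis (n : ℕ) : Type := Fin n → Fin 2

/-- Operators on `n` qubits, as matrices in the computational basis (`U y x` is the amplitude
of the output `y` on the input `x`). -/
abbrev Op (n : ℕ) : Type := Matrix (Basis n) (Basis n) ℂ

/-- The integer value of a register whose qubit `0` is the most significant one. -/
def msbVal {n : ℕ} (x : Basis n) : ℕ := ∑ k : Fin n, (x k : ℕ) * 2 ^ (n - 1 - (k : ℕ))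

/-- The integer value of a register whose qubit `0` is the least significant one. -/
def lsbVal {n : ℕ} (y : Basis n) : ℕ := ∑ k : Fin n, (y k : ℕ) * 2 ^ (k : ℕ)

/-- The quantum Fourier transform modulo `2 ^ n`, in the indexing in which its input is read with
the most significant qubit first and its output with the least significant qubit first. -/
def qft (n : ℕ) : Op n := Matrix.of fun y x =>
  ((Real.sqrt (2 ^ n))⁻¹ : ℂ) *
    Complex.exp (2 * Real.pi * Complex.I * (msbVal x : ℂ) * (lsbVal y : ℂ) / 2 ^ n)

/-- The operator `U` on `k` qubits, applied to the qubits `f 0, …, f (k - 1)` of an `n`-qubit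
register (`f` is injective wherever this is used), with the identity on the other qubits. -/
def onQubits {k n : ℕ} (f : Fin k → Fin n) (U : Op k) : Op n :=
  open Classical in
  Matrix.of fun y x => if ∀ q, q ∉ Set.range f → y q = x q then U (y ∘ f) (x ∘ f) else 0

/-! ### Block circuits -/

/-- The number of qubits of block `i`, where `n` qubits are divided into consecutive blocks of `m`
qubits, the last of which is shorter if `m` does not divide `n`. -/
def blockSize (n m i : ℕ) : ℕ := min m (n - m * i)

/-- The qubits of block `i`, in order. -/
def blockQubit (n m i : ℕ) (k : Fin (blockSize n m i)) : Fin n :=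
  ⟨m * i + k, by
    have hk := k.isLt
    have h : blockSize n m i ≤ n - m * i := min_le_right _ _
    omega⟩

/-- The phase rotation `exp (2πi X_{i+1} Y_i / 2 ^ (2m))` between the blocks `i` and `i + 1`;
if block `i + 1` is a shorter last block, then `2m` is replaced by the total size of the two. -/
def blockPhase (n m i : ℕ) : Op n := Matrix.diagonal fun x =>
  Complex.exp (2 * Real.pi * Complex.I * (msbVal (x ∘ blockQubit n m (i + 1)) : ℂ) *
    (lsbVal (x ∘ blockQubit n m i) : ℂ) / 2 ^ (blockSize n m i + blockSize n m (i + 1)))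

/-- The gates of block circuits: the QFT on a block, its inverse, and the phase rotation between
block `i` and block `i + 1`. -/
inductive BlockGate : Type
  | qft (i : ℕ)
  | qftInv (i : ℕ)
  | phase (i : ℕ)

/-- The blocks on which a block gate acts. -/
def BlockGate.blocks : BlockGate → Finset ℕ
  | .qft i => {i}
  | .qftInv i => {i}
  | .phase i => {i, i + 1}

/-- The operator of a block gate. -/
def BlockGate.eval (n m : ℕ) : BlockGate → Op n
  | .qft i => onQubits (blockQubit n m i) (OptimisticQFT.qft (blockSize n m i))
  | .qftInv i => onQubits (blockQubit n m i) (OptimisticQFT.qft (blockSize n m i))ᴴ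
  | .phase i => blockPhase n m i

/-- The product of a list of operators, the head of the list being applied first. -/
def compose {n : ℕ} : List (Op n) → Op n
  | [] => 1
  | U :: Us => compose Us * U

/-- The operator of one step of a block circuit. -/
def stepEval (n m : ℕ) (s : List BlockGate) : Op n := compose (s.map (BlockGate.eval n m))

/-- The operator of a block circuit, its steps being applied one after the other. -/
def blockEval (n m : ℕ) (S : List (List BlockGate)) : Op n := compose (S.map (stepEval n m))

/-- The even-indexed ones among `0, …, N - 1`. -/
def evens (N : ℕ) : List ℕ := (List.range N).filter fun i => i % 2 = 0

/-- The odd-indexed ones among `0, …, N - 1`. -/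
def odds (N : ℕ) : List ℕ := (List.range N).filter fun i => i % 2 = 1

/-- The five steps of the optimistic QFT on `n` qubits with block size `m`. The blocks are
`0, …, ⌈n / m⌉ - 1`, the pairs of neighbouring blocks `(i, i + 1)` have `i < ⌈n / m⌉ - 1`. -/
def oqft (n m : ℕ) : List (List BlockGate) :=
  let N := n ⌈/⌉ m
  [ (evens N).map .qft,
    (evens (N - 1)).map .phase,
    (odds N).map .qft ++ (evens N).map .qftInv,
    (odds (N - 1)).map .phase,
    (evens N).map .qft ]

/-! ### Circuits of elementary gates -/

/-- The elementary gates on `n` qubits: Hadamard gates and controlled phase gates. -/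
inductive Gate (n : ℕ) : Type
  | hadamard (q : Fin n)
  | cphase (θ : ℝ) (p q : Fin n) (hpq : p ≠ q)

/-- The qubits on which a gate acts. -/
def Gate.support {n : ℕ} : Gate n → Finset (Fin n)
  | .hadamard q => {q}
  | .cphase _ p q _ => {p, q}

/-- The Hadamard matrix. -/
def hadamardOp : Op 1 := Matrix.of fun y x =>
  ((Real.sqrt 2)⁻¹ : ℂ) * (-1) ^ ((x 0 : ℕ) * (y 0 : ℕ))

/-- The controlled phase gate `diag (1, 1, 1, exp (iθ))`. -/
def cphaseOp (θ : ℝ) : Op 2 := Matrix.diagonal fun x =>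
  Complex.exp (Complex.I * θ * ((x 0 : ℕ) : ℂ) * ((x 1 : ℕ) : ℂ))

/-- The operator of a gate. -/
def Gate.eval {n : ℕ} : Gate n → Op n
  | .hadamard q => onQubits ![q] hadamardOp
  | .cphase θ p q _ => onQubits ![p, q] (cphaseOp θ)

/-- A layer of a circuit: gates on pairwise disjoint sets of qubits, applied in parallel. -/
structure Layer (n : ℕ) where
  gates : List (Gate n)
  disjoint : gates.Pairwise fun g h => Disjoint g.support h.support

/-- A circuit on `n` qubits (without ancillas or measurements) is a sequence of layers. -/
abbrev Circuit (n : ℕ) : Type := List (Layer n)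

/-- The depth of a circuit is the number of its layers. -/
def Circuit.depth {n : ℕ} (c : Circuit n) : ℕ := List.length c

/-- The operator of a circuit, the first layer being applied first. -/
def Circuit.eval {n : ℕ} (c : Circuit n) : Op n :=
  compose (List.map (fun L : Layer n => compose (L.gates.map Gate.eval)) c)

/-- Every gate of the circuit acts inside one block or inside two neighbouring blocks
(block size `m`). -/
def Circuit.IsBlockLocal {n : ℕ} (m : ℕ) (c : Circuit n) : Prop :=
  ∀ L ∈ c, ∀ g ∈ L.gates, ∀ p ∈ g.support, ∀ q ∈ g.support, (p : ℕ) / m ≤ (q : ℕ) / m + 1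

/-! ### Optimistic circuits -/

/-- The operator `U'` induced by a circuit is an optimistic implementation of the unitary `U` with
error `ε`: both are unitary, and `‖U' - U‖_F ^ 2 / dim ≤ ε` with `‖E‖_F ^ 2 = Tr (E† E)`. -/
structure IsOptimistic {n : ℕ} (U' U : Op n) (ε : ℝ) : Prop where
  unitary_circuit : U' ∈ Matrix.unitaryGroup (Basis n) ℂ
  unitary_target : U ∈ Matrix.unitaryGroup (Basis n) ℂ
  error_le : (Matrix.trace ((U' - U)ᴴ * (U' - U))).re / 2 ^ n ≤ ε

end OptimisticQFT

end

noncomputable section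

namespace OptimisticQFT

/-! ### Operators on subsets of the qubits -/

/-! The entry of the QFT at `(y, x)` has modulus `2^(-n/2)` and phase `X(x) Y(y) / 2^n`. Split into
blocks, this phase is a sum over pairs (output block `i`, input block `j`). Pairs with `j < i`
contribute integers, `j = i` gives the block QFTs, `j = i + 1` the neighbour rotations, and the
pairs with `j ≥ i + 2` decay geometrically with ratio `2^(-m)` (`turn_qftPhase`, `farPhase_le`).
Dropping the last kind gives the matrix `neighbourQft`, close to the QFT in Frobenius norm.

Every neighbour rotation touches exactly one even block, so an entry of `neighbourQft` is a product
over blocks. An even block contributes `S_b F R_a`, with `F` the block QFT, `R_a` and `S_b` diagonal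
rotations, `a` read from the output on the left odd block and `b` from the input on the right odd
block. The optimistic circuit has the same product form, with `F R_a F† S_b F` instead
(`blockEval_oqft_apply`). Put `T_b = F† S_b F`; then the two are `F T_b R_a` and `F R_a T_b`, which
differ only in the order of `R_a` and `T_b`. The matrix `T_b` is a translation by `b ∈ [0, 1]` of a
unit, concentrated near the diagonal modulo `M = 2^m`, and `R_a` varies slowly except at the
wraparound, which few basis states see. Hence the normalized overlap of the two is `1 - O(M^(-1/2))`
(`norm_one_sub_blockOverlap_le`). The worst-case error of the circuit need not be small; only this
average over inputs is.

Since `a` and `b` depend on odd blocks only, the total overlap can be averaged over each even block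
independently (`sum_prod_average`), and the defects add up to `O(n / 2^(m/2))`. Overlap close to `1`
together with equal Frobenius norms bounds the Frobenius distance, and `m = ⌈40 ln (n/ε)⌉` makes the
total at most `ε`.

For the depth, QFTs and phase rotations on blocks of at most `m` qubits are scheduled in `2m` layers
by the sum of the two qubit indices (`qftLayer_mul_partialQft`, `implementable_blockPhase`); gates
on disjoint blocks run in parallel. Unitarity is read off from these circuits. -/

open Classical in
theorem onQubits_apply {k n : ℕ} (f : Fin k → Fin n) (U : Op k) (y x : Basis n) :
    onQubits f U y x =
      if ∀ q, q ∉ Set.range f → y q = x q then U (y ∘ f) (x ∘ f) else 0 := rfl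

theorem extend_comp_self {k n : ℕ} {f : Fin k → Fin n} (hf : Function.Injective f)
    (u : Basis k) (x : Basis n) : Function.extend f u x ∘ f = u :=
  funext fun i => hf.extend_apply u x i

theorem extend_of_notMem {k n : ℕ} {f : Fin k → Fin n} (u : Basis k) (x : Basis n) {q : Fin n}
    (hq : q ∉ Set.range f) : Function.extend f u x q = x q :=
  Function.extend_apply' _ _ _ hq

theorem extend_comp_eq {k n : ℕ} {f : Fin k → Fin n} (hf : Function.Injective f)
    {z x : Basis n} (h : ∀ q, q ∉ Set.range f → z q = x q) :
    Function.extend f (z ∘ f) x = z := by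
  funext q
  by_cases hq : q ∈ Set.range f
  · obtain ⟨i, rfl⟩ := hq
    exact hf.extend_apply _ _ i
  · rw [extend_of_notMem _ _ hq, h q hq]

theorem extend_comp_disjoint {k l n : ℕ} {f : Fin k → Fin n} {g : Fin l → Fin n}
    (h : Disjoint (Set.range f) (Set.range g)) (u : Basis k) (x : Basis n) :
    Function.extend f u x ∘ g = x ∘ g :=
  funext fun i => extend_of_notMem _ _ fun hi => Set.disjoint_left.1 h hi ⟨i, rfl⟩

open Classical in
theorem sum_extend {k n : ℕ} {f : Fin k → Fin n} (hf : Function.Injective f) (x : Basis n)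
    (F : Basis n → ℂ) :
    ∑ z, (if ∀ q, q ∉ Set.range f → z q = x q then F z else 0) =
      ∑ u, F (Function.extend f u x) := by
  rw [← Finset.sum_filter]
  refine Finset.sum_nbij' (fun z => z ∘ f) (fun u => Function.extend f u x) (by simp) ?_ ?_ ?_ ?_
  · intro u _
    simp only [Finset.mem_filter, Finset.mem_univ, true_and]
    exact fun q hq => extend_of_notMem _ _ hq
  · intro z hz
    exact extend_comp_eq hf (by simpa using hz)
  · intro u _
    exact extend_comp_self hf u x
  · intro z hz
    rw [extend_comp_eq hf (by simpa using hz)]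

/-- The overwritten bits of `x` are forgotten, so each string arises from exactly `2 ^ k` pairs `(x,
u)`. -/
theorem sum_sum_extend {k n : ℕ} {f : Fin k → Fin n} (hf : Function.Injective f)
    (F : Basis n → ℂ) :
    ∑ x, ∑ u, F (Function.extend f u x) = 2 ^ k * ∑ x, F x := by
  classical
  have h (z : Basis n) :
      ∑ x : Basis n, (if ∀ q, q ∉ Set.range f → z q = x q then (1 : ℂ) else 0) = 2 ^ k := by
    have := sum_extend hf z fun _ => (1 : ℂ)
    simp only [eq_comm (a := z _)]
    simpa using this
  simp only [← sum_extend hf]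
  rw [Finset.sum_comm, Finset.mul_sum]
  refine Finset.sum_congr rfl fun z _ => ?_
  rw [← h z, Finset.sum_mul]
  exact Finset.sum_congr rfl fun x _ => by split_ifs <;> simp

theorem onQubits_mul_apply {k n : ℕ} {f : Fin k → Fin n} (hf : Function.Injective f) (U : Op k)
    (A : Op n) (y x : Basis n) :
    (onQubits f U * A) y x = ∑ u, U (y ∘ f) u * A (Function.extend f u y) x := by
  classical
  rw [Matrix.mul_apply]
  have := sum_extend hf y fun z => U (y ∘ f) (z ∘ f) * A z x
  simp only [extend_comp_self hf] at this
  rw [← this]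
  refine Finset.sum_congr rfl fun z _ => ?_
  rw [onQubits_apply]
  simp only [eq_comm (a := y _)]
  split_ifs <;> simp

theorem onQubits_mul {k n : ℕ} {f : Fin k → Fin n} (hf : Function.Injective f) (U V : Op k) :
    onQubits f (U * V) = onQubits f U * onQubits f V := by
  classical
  ext y x
  rw [onQubits_mul_apply hf, onQubits_apply]
  simp only [onQubits_apply, extend_comp_self hf]
  have h (u : Basis k) : (∀ q, q ∉ Set.range f → Function.extend f u y q = x q) ↔
      ∀ q, q ∉ Set.range f → y q = x q :=
    forall₂_congr fun q hq => by rw [extend_of_notMem _ _ hq]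
  simp only [h]
  split_ifs
  · rw [Matrix.mul_apply]
  · simp

theorem onQubits_one {k n : ℕ} (f : Fin k → Fin n) : onQubits f (1 : Op k) = 1 := by
  classical
  ext y x
  rw [onQubits_apply, Matrix.one_apply, Matrix.one_apply, ← ite_and]
  refine if_congr ⟨fun h => funext fun q => ?_, fun h => by simp [h]⟩ rfl rfl
  by_cases hq : q ∈ Set.range f
  · obtain ⟨i, rfl⟩ := hq
    exact congrFun h.2 i
  · exact h.1 q hq

theorem onQubits_conjTranspose {k n : ℕ} (f : Fin k → Fin n) (U : Op k) :
    onQubits f Uᴴ = (onQubits f U)ᴴ := by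
  classical
  ext y x
  rw [Matrix.conjTranspose_apply, onQubits_apply, onQubits_apply]
  simp only [eq_comm (a := x _)]
  split_ifs <;> simp

theorem onQubits_onQubits {j k n : ℕ} {f : Fin k → Fin n} (hf : Function.Injective f)
    (g : Fin j → Fin k) (U : Op j) : onQubits f (onQubits g U) = onQubits (f ∘ g) U := by
  classical
  ext y x
  rw [onQubits_apply, onQubits_apply, onQubits_apply, ← ite_and]
  refine if_congr ⟨fun h q hq => ?_, fun h => ⟨fun q hq => h q ?_, fun i hi => h (f i) ?_⟩⟩ rfl rfl
  · by_cases hq' : q ∈ Set.range f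
    · obtain ⟨i, rfl⟩ := hq'
      refine h.2 i fun hi => hq ?_
      obtain ⟨a, rfl⟩ := hi
      exact ⟨a, rfl⟩
    · exact h.1 q hq'
  · rintro ⟨a, rfl⟩
    exact hq ⟨g a, rfl⟩
  · rintro ⟨a, ha⟩
    exact hi ⟨a, hf ha⟩

-- The formula is symmetric in the two factors, which yields `onQubits_commute`.
open Classical in
theorem onQubits_mul_onQubits_apply {j k n : ℕ} {f : Fin j → Fin n} {g : Fin k → Fin n}
    (hf : Function.Injective f) (hfg : Disjoint (Set.range f) (Set.range g)) (U : Op j) (V : Op k)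
    (y x : Basis n) :
    (onQubits f U * onQubits g V) y x =
      if ∀ q, q ∉ Set.range f → q ∉ Set.range g → y q = x q then
        U (y ∘ f) (x ∘ f) * V (y ∘ g) (x ∘ g) else 0 := by
  rw [onQubits_mul_apply hf, Finset.sum_eq_single (x ∘ f)]
  · rw [onQubits_apply, extend_comp_disjoint hfg]
    have : (∀ q, q ∉ Set.range g → Function.extend f (x ∘ f) y q = x q) ↔
        ∀ q, q ∉ Set.range f → q ∉ Set.range g → y q = x q := by
      refine ⟨fun h q hf hg => by rw [← h q hg, extend_of_notMem _ _ hf], fun h q hg => ?_⟩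
      by_cases hq : q ∈ Set.range f
      · obtain ⟨i, rfl⟩ := hq
        exact hf.extend_apply _ _ i
      · rw [extend_of_notMem _ _ hq, h q hq hg]
    simp only [this]
    split_ifs <;> simp
  · intro u _ hu
    rw [onQubits_apply, if_neg, mul_zero]
    intro h
    refine hu (funext fun i => ?_)
    rw [← hf.extend_apply u y i]
    exact h _ (Set.disjoint_left.1 hfg ⟨i, rfl⟩)
  · simp

theorem onQubits_commute {j k n : ℕ} {f : Fin j → Fin n} {g : Fin k → Fin n}
    (hf : Function.Injective f) (hg : Function.Injective g)
    (hfg : Disjoint (Set.range f) (Set.range g)) (U : Op j) (V : Op k) :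
    Commute (onQubits f U) (onQubits g V) := by
  classical
  ext y x
  rw [onQubits_mul_onQubits_apply hf hfg, onQubits_mul_onQubits_apply hg hfg.symm, mul_comm]
  exact if_congr ⟨fun h q h₁ h₂ => h q h₂ h₁, fun h q h₁ h₂ => h q h₂ h₁⟩ rfl rfl

theorem onQubits_mem_unitaryGroup {k n : ℕ} {f : Fin k → Fin n} (hf : Function.Injective f)
    {U : Op k} (hU : U ∈ Matrix.unitaryGroup (Basis k) ℂ) :
    onQubits f U ∈ Matrix.unitaryGroup (Basis n) ℂ := by
  rw [Matrix.mem_unitaryGroup_iff, Matrix.star_eq_conjTranspose] at hU ⊢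
  rw [← onQubits_conjTranspose, ← onQubits_mul hf, hU, onQubits_one]

/-! ### Composition of operators -/

theorem compose_append {n : ℕ} (l₁ l₂ : List (Op n)) :
    compose (l₁ ++ l₂) = compose l₂ * compose l₁ := by
  induction l₁ with
  | nil => simp [compose]
  | cons a l ih => simp [compose, ih, Matrix.mul_assoc]

theorem compose_commute {n : ℕ} {A : Op n} {l : List (Op n)} (h : ∀ B ∈ l, Commute A B) :
    Commute A (compose l) := by
  induction l with
  | nil => exact Commute.one_right A
  | cons B l ih =>
    exact (ih fun C hC => h C (List.mem_cons_of_mem _ hC)).mul_right (h B List.mem_cons_self)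

theorem compose_eq_one {n : ℕ} {l : List (Op n)} (h : ∀ A ∈ l, A = 1) : compose l = 1 := by
  induction l with
  | nil => rfl
  | cons A l ih =>
    rw [compose, ih fun B hB => h B (List.mem_cons_of_mem _ hB), h A List.mem_cons_self, mul_one]

theorem compose_mem_unitaryGroup {n : ℕ} {l : List (Op n)}
    (h : ∀ U ∈ l, U ∈ Matrix.unitaryGroup (Basis n) ℂ) :
    compose l ∈ Matrix.unitaryGroup (Basis n) ℂ := by
  induction l with
  | nil => exact one_mem _
  | cons B l ih =>
    exact mul_mem (ih fun C hC => h C (List.mem_cons_of_mem _ hC)) (h B List.mem_cons_self)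

theorem compose_diagonal {ι : Type*} {n : ℕ} (l : List ι) (d : ι → Basis n → ℂ) :
    compose (l.map fun i => Matrix.diagonal (d i)) =
      Matrix.diagonal fun x => (l.map fun i => d i x).prod := by
  induction l with
  | nil => simp [compose]
  | cons a l ih => simp [compose, ih, Matrix.diagonal_mul_diagonal, mul_comm]

theorem compose_reverse_conjTranspose {n : ℕ} (l : List (Op n)) :
    compose (l.reverse.map Matrix.conjTranspose) = (compose l)ᴴ := by
  induction l with
  | nil => simp [compose]
  | cons a l ih =>
    rw [List.reverse_cons, List.map_append, compose_append, ih]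
    simp [compose]

theorem onQubits_compose {k n : ℕ} {f : Fin k → Fin n} (hf : Function.Injective f)
    (l : List (Op k)) : onQubits f (compose l) = compose (l.map (onQubits f)) := by
  induction l with
  | nil => simp [compose, onQubits_one]
  | cons a l ih => simp [compose, onQubits_mul hf, ih]

/-! ### Phases -/

/-- The phase `exp (2πi t)`. -/
def turn (t : ℝ) : ℂ := Complex.exp ((2 * Real.pi * t : ℝ) * Complex.I)

theorem turn_zero : turn 0 = 1 := by simp [turn]

theorem turn_add (s t : ℝ) : turn (s + t) = turn s * turn t := by
  rw [turn, turn, turn, ← Complex.exp_add]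
  push_cast
  ring_nf

theorem turn_sum {ι : Type*} (s : Finset ι) (f : ι → ℝ) :
    turn (∑ i ∈ s, f i) = ∏ i ∈ s, turn (f i) := by
  induction s using Finset.cons_induction with
  | empty => simp [turn_zero]
  | cons a s ha ih => rw [Finset.sum_cons, Finset.prod_cons, turn_add, ih]

theorem norm_turn (t : ℝ) : ‖turn t‖ = 1 := Complex.norm_exp_ofReal_mul_I _

theorem turn_int (k : ℤ) : turn k = 1 := by
  rw [turn, Complex.exp_eq_one_iff]
  exact ⟨k, by push_cast; ring⟩

theorem turn_add_int (t : ℝ) (k : ℤ) : turn (t + k) = turn t := by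
  rw [turn_add, turn_int, mul_one]

theorem star_turn (t : ℝ) : star (turn t) = turn (-t) := by
  rw [turn, turn, Complex.star_def, ← Complex.exp_conj, map_mul, Complex.conj_I,
    Complex.conj_ofReal]
  push_cast
  ring_nf

theorem star_turn_mul_self (t : ℝ) : star (turn t) * turn t = 1 := by
  rw [star_turn, ← turn_add, neg_add_cancel, turn_zero]

theorem turn_nat_mul (k : ℕ) (t : ℝ) : turn (k * t) = turn t ^ k := by
  rw [turn, turn, ← Complex.exp_nat_mul]
  push_cast
  ring_nf

theorem norm_one_sub_turn_le (t : ℝ) : ‖1 - turn t‖ ≤ 2 * Real.pi * |t| := by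
  rw [norm_sub_rev, turn, mul_comm]
  refine (Real.norm_exp_I_mul_ofReal_sub_one_le (x := 2 * Real.pi * t)).trans ?_
  rw [Real.norm_eq_abs, abs_mul, abs_of_pos Real.two_pi_pos]

theorem qft_apply (n : ℕ) (y x : Basis n) :
    qft n y x = ((Real.sqrt (2 ^ n))⁻¹ : ℂ) * turn (msbVal x * lsbVal y / 2 ^ n) := by
  rw [qft, Matrix.of_apply, turn]
  push_cast
  ring_nf

/-! ### Elementary gates -/

theorem injective_single {n : ℕ} (q : Fin n) : Function.Injective ![q] :=
  Function.injective_of_subsingleton _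

theorem injective_pair {n : ℕ} {p q : Fin n} (h : p ≠ q) : Function.Injective ![p, q] := by
  intro i j hij
  fin_cases i <;> fin_cases j <;> simp_all [eq_comm]

theorem hadamardOp_apply (y x : Basis 1) :
    hadamardOp y x = ((Real.sqrt 2)⁻¹ : ℂ) * turn ((y 0 : ℕ) * (x 0 : ℕ) / 2) := by
  have h : turn (1 / 2) = -1 := by
    rw [turn, ← Complex.exp_pi_mul_I]
    push_cast
    ring_nf
  have h2 : ((y 0 : ℕ) * (x 0 : ℕ) / 2 : ℝ) = ((x 0 : ℕ) * (y 0 : ℕ) : ℕ) * (1 / 2) := by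
    push_cast
    ring
  rw [h2, turn_nat_mul, h, hadamardOp, Matrix.of_apply]

theorem sqrt_two_inv_mul_self : ((Real.sqrt 2)⁻¹ : ℂ) * ((Real.sqrt 2)⁻¹ : ℂ) = 1 / 2 := by
  rw [← mul_inv, ← Complex.ofReal_mul, Real.mul_self_sqrt (by norm_num)]
  norm_num

theorem hadamardOp_conjTranspose : hadamardOpᴴ = hadamardOp := by
  ext y x
  simp [hadamardOp, Matrix.conjTranspose_apply, mul_comm]

theorem hadamardOp_mem_unitaryGroup : hadamardOp ∈ Matrix.unitaryGroup (Basis 1) ℂ := by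
  rw [Matrix.mem_unitaryGroup_iff, Matrix.star_eq_conjTranspose, hadamardOp_conjTranspose]
  have key (a b : Fin 2) : ∑ u : Fin 2, ((Real.sqrt 2)⁻¹ : ℂ) * (-1) ^ ((u : ℕ) * (a : ℕ)) *
      (((Real.sqrt 2)⁻¹ : ℂ) * (-1) ^ ((b : ℕ) * (u : ℕ))) = if a = b then 1 else 0 := by
    have h := sqrt_two_inv_mul_self
    fin_cases a <;> fin_cases b <;> (simp [h]; try norm_num)
  ext y x
  rw [Matrix.mul_apply, Matrix.one_apply, ← (Equiv.funUnique (Fin 1) (Fin 2)).symm.sum_comp]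
  have : y = x ↔ y 0 = x 0 :=
    ⟨fun h => by rw [h], fun h => funext fun i => by rwa [Subsingleton.elim i 0]⟩
  simp only [this, ← key, hadamardOp, Matrix.of_apply]
  rfl

theorem cphaseOp_conjTranspose (θ : ℝ) : (cphaseOp θ)ᴴ = cphaseOp (-θ) := by
  rw [cphaseOp, cphaseOp, Matrix.diagonal_conjTranspose]
  congr 1
  funext x
  simp [← Complex.exp_conj]

theorem cphaseOp_mem_unitaryGroup (θ : ℝ) : cphaseOp θ ∈ Matrix.unitaryGroup (Basis 2) ℂ := by
  rw [Matrix.mem_unitaryGroup_iff, Matrix.star_eq_conjTranspose, cphaseOp_conjTranspose, cphaseOp,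
    cphaseOp, Matrix.diagonal_mul_diagonal, ← Matrix.diagonal_one]
  congr 1
  funext x
  rw [← Complex.exp_add]
  simp

/-- The gate with the adjoint operator. -/
def Gate.inv {n : ℕ} : Gate n → Gate n
  | .hadamard q => .hadamard q
  | .cphase θ p q h => .cphase (-θ) p q h

/-- The gate on the qubits of a larger register selected by `f`. -/
def Gate.map {k n : ℕ} {f : Fin k → Fin n} (hf : Function.Injective f) : Gate k → Gate n
  | .hadamard q => .hadamard (f q)
  | .cphase θ p q h => .cphase θ (f p) (f q) (hf.ne h)

theorem Gate.inv_support {n : ℕ} (g : Gate n) : g.inv.support = g.support := by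
  cases g <;> rfl

theorem Gate.inv_eval {n : ℕ} (g : Gate n) : g.inv.eval = g.evalᴴ := by
  cases g <;> simp [Gate.inv, Gate.eval, ← onQubits_conjTranspose, hadamardOp_conjTranspose,
    cphaseOp_conjTranspose]

theorem Gate.map_support {k n : ℕ} {f : Fin k → Fin n} (hf : Function.Injective f) (g : Gate k) :
    (g.map hf).support = g.support.image f := by
  cases g <;> simp [Gate.map, Gate.support, Finset.image_insert]

theorem Gate.map_eval {k n : ℕ} {f : Fin k → Fin n} (hf : Function.Injective f) (g : Gate k) :
    (g.map hf).eval = onQubits f g.eval := by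
  cases g <;> simp only [Gate.map, Gate.eval, onQubits_onQubits hf] <;> congr 1 <;>
    funext i <;> fin_cases i <;> rfl

theorem Gate.eval_mem_unitaryGroup {n : ℕ} (g : Gate n) :
    g.eval ∈ Matrix.unitaryGroup (Basis n) ℂ := by
  cases g with
  | hadamard q => exact onQubits_mem_unitaryGroup (injective_single q) hadamardOp_mem_unitaryGroup
  | cphase θ p q h => exact onQubits_mem_unitaryGroup (injective_pair h) (cphaseOp_mem_unitaryGroup θ)

theorem Gate.exists_eval_eq {n : ℕ} (g : Gate n) :
    ∃ (k : ℕ) (f : Fin k → Fin n) (U : Op k),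
      Function.Injective f ∧ Set.range f = g.support ∧ g.eval = onQubits f U := by
  cases g with
  | hadamard q => exact ⟨1, _, _, injective_single q, by simp [Gate.support], rfl⟩
  | cphase θ p q h => exact ⟨2, _, _, injective_pair h, by simp [Gate.support, Set.pair_comm], rfl⟩

theorem Gate.eval_commute {n : ℕ} {g h : Gate n} (hgh : Disjoint g.support h.support) :
    Commute g.eval h.eval := by
  obtain ⟨k, f, U, hf, hfr, hU⟩ := g.exists_eval_eq
  obtain ⟨k', f', V, hf', hfr', hV⟩ := h.exists_eval_eq
  rw [hU, hV]
  refine onQubits_commute hf hf' ?_ U V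
  rw [hfr, hfr']
  exact_mod_cast hgh

theorem Gate.eval_cphase {n : ℕ} (t : ℝ) (p q : Fin n) (h : p ≠ q) :
    (Gate.cphase (2 * Real.pi * t) p q h).eval =
      Matrix.diagonal fun x => turn ((x p : ℕ) * (x q : ℕ) * t) := by
  classical
  ext y x
  rw [Gate.eval, onQubits_apply, cphaseOp, Matrix.diagonal_apply, Matrix.diagonal_apply, ← ite_and]
  refine if_congr ⟨fun hyx => funext fun r => ?_, fun h => by simp [h]⟩ ?_ rfl
  · by_cases hr : r ∈ Set.range ![p, q]
    · obtain ⟨i, rfl⟩ := hr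
      exact congrFun hyx.2 i
    · exact hyx.1 r hr
  · simp only [turn, Function.comp_apply, Matrix.cons_val_zero, Matrix.cons_val_one]
    push_cast
    ring_nf

/-! ### Operators implemented by circuits of a given depth -/

/-- The operator `U` is implemented by a circuit of depth `D` all of whose gates satisfy `P`. -/
def Implementable {n : ℕ} (D : ℕ) (P : Gate n → Prop) (U : Op n) : Prop :=
  ∃ c : Circuit n, c.depth = D ∧ c.eval = U ∧ ∀ L ∈ c, ∀ g ∈ L.gates, P g

theorem Circuit.eval_cons {n : ℕ} (L : Layer n) (c : Circuit n) :
    Circuit.eval (L :: c : Circuit n) = Circuit.eval c * compose (L.gates.map Gate.eval) := rfl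

theorem Circuit.eval_mem_unitaryGroup {n : ℕ} (c : Circuit n) :
    c.eval ∈ Matrix.unitaryGroup (Basis n) ℂ := by
  refine compose_mem_unitaryGroup fun U hU => ?_
  obtain ⟨L, -, rfl⟩ := List.mem_map.1 hU
  refine compose_mem_unitaryGroup fun V hV => ?_
  obtain ⟨g, -, rfl⟩ := List.mem_map.1 hV
  exact g.eval_mem_unitaryGroup

theorem Implementable.mem_unitaryGroup {n D : ℕ} {P : Gate n → Prop} {U : Op n}
    (h : Implementable D P U) : U ∈ Matrix.unitaryGroup (Basis n) ℂ := by
  obtain ⟨c, -, rfl, -⟩ := h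
  exact c.eval_mem_unitaryGroup

theorem Implementable.mono {n D : ℕ} {P Q : Gate n → Prop} {U : Op n} (h : Implementable D P U)
    (hPQ : ∀ g, P g → Q g) : Implementable D Q U := by
  obtain ⟨c, hD, hU, hP⟩ := h
  exact ⟨c, hD, hU, fun L hL g hg => hPQ g (hP L hL g hg)⟩

/-- Layers may be empty, so a prescribed depth is attained exactly; equal depths are what allows
`Implementable.parallel` to merge circuits layer by layer. -/
theorem implementable_of_layers {n : ℕ} (D : ℕ) (P : Gate n → Prop) (G : ℕ → List (Gate n))
    (hd : ∀ t, (G t).Pairwise fun g h => Disjoint g.support h.support)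
    (hP : ∀ t, ∀ g ∈ G t, P g) :
    Implementable D P
      (compose ((List.range D).map fun t => compose ((G t).map Gate.eval))) := by
  refine ⟨(List.range D).map fun t => ⟨G t, hd t⟩, by simp [Circuit.depth], ?_, ?_⟩
  · simp [Circuit.eval, Function.comp_def]
  · simpa using fun t _ => hP t

theorem implementable_one {n : ℕ} (D : ℕ) (P : Gate n → Prop) : Implementable D P (1 : Op n) := by
  have h := implementable_of_layers D P (fun _ => []) (by simp) (by simp)
  rwa [compose_eq_one] at h
  intro A hA
  obtain ⟨t, -, rfl⟩ := List.mem_map.1 hA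
  rfl

/-- The layer of the inverse gates. -/
def Layer.inv {n : ℕ} (L : Layer n) : Layer n where
  gates := (L.gates.map Gate.inv).reverse
  disjoint := by
    rw [List.pairwise_reverse, List.pairwise_map]
    simpa only [Gate.inv_support, disjoint_comm] using L.disjoint

theorem Implementable.conjTranspose {n D : ℕ} {P : Gate n → Prop} {U : Op n}
    (h : Implementable D P U) (hP : ∀ g, P g → P g.inv) : Implementable D P Uᴴ := by
  obtain ⟨c, hD, rfl, hc⟩ := h
  refine ⟨(c.map Layer.inv).reverse, ?_, ?_, ?_⟩
  · simpa [Circuit.depth] using hD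
  · rw [Circuit.eval, Circuit.eval, ← compose_reverse_conjTranspose]
    congr 1
    simp only [List.map_reverse, List.map_map]
    congr 2
    funext L
    simp only [Function.comp_apply]
    rw [← compose_reverse_conjTranspose]
    congr 1
    simp [Layer.inv, Function.comp_def, Gate.inv_eval]
  · intro L hL g hg
    simp only [List.mem_reverse, List.mem_map] at hL
    obtain ⟨L, hL, rfl⟩ := hL
    simp only [Layer.inv, List.mem_reverse, List.mem_map] at hg
    obtain ⟨g, hg, rfl⟩ := hg
    exact hP g (hc L hL g hg)

theorem Implementable.onQubits {k n D : ℕ} {P : Gate k → Prop} {U : Op k} {f : Fin k → Fin n}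
    (hf : Function.Injective f) (h : Implementable D P U) :
    Implementable D (fun g => ∀ q ∈ g.support, q ∈ Set.range f) (onQubits f U) := by
  obtain ⟨c, hD, rfl, -⟩ := h
  refine ⟨c.map fun L => ⟨L.gates.map (Gate.map hf), ?_⟩, ?_, ?_, ?_⟩
  · rw [List.pairwise_map]
    simpa only [Gate.map_support, Finset.disjoint_image hf] using L.disjoint
  · simpa [Circuit.depth] using hD
  · rw [Circuit.eval, Circuit.eval, onQubits_compose hf]
    congr 1
    simp [Function.comp_def, onQubits_compose hf, Gate.map_eval]
  · intro L hL g hg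
    simp only [List.mem_map] at hL
    obtain ⟨L, hL, rfl⟩ := hL
    simp only [List.mem_map] at hg
    obtain ⟨g, hg, rfl⟩ := hg
    intro q hq
    rw [Gate.map_support] at hq
    obtain ⟨a, -, rfl⟩ := Finset.mem_image.1 hq
    exact ⟨a, rfl⟩

/-- Circuits on disjoint sets of qubits can be run in parallel. -/
theorem Implementable.parallel {n D : ℕ} {P Q : Gate n → Prop} {U V : Op n}
    (hPQ : ∀ g h, P g → Q h → Disjoint g.support h.support)
    (hU : Implementable D P U) (hV : Implementable D Q V) :
    Implementable D (fun g => P g ∨ Q g) (V * U) := by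
  obtain ⟨c, hc, rfl, hP⟩ := hU
  obtain ⟨d, hd, rfl, hQ⟩ := hV
  induction D generalizing c d with
  | zero =>
    obtain rfl := List.length_eq_zero_iff.1 hc
    obtain rfl := List.length_eq_zero_iff.1 hd
    exact ⟨[], rfl, (Matrix.one_mul 1).symm, by simp⟩
  | succ D ih =>
    obtain ⟨L, c, rfl⟩ := List.exists_cons_of_length_eq_add_one hc
    obtain ⟨M, d, rfl⟩ := List.exists_cons_of_length_eq_add_one hd
    rw [List.forall_mem_cons] at hP hQ
    obtain ⟨e, he, hev, hR⟩ := ih c (Nat.succ_injective hc) hP.2 d (Nat.succ_injective hd) hQ.2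
    refine ⟨⟨L.gates ++ M.gates, ?_⟩ :: e, congrArg Nat.succ he, ?_, ?_⟩
    · rw [List.pairwise_append]
      exact ⟨L.disjoint, M.disjoint, fun g hg h hh => hPQ g h (hP.1 g hg) (hQ.1 h hh)⟩
    -- Merging moves the first layer of the second circuit past the remaining layers of the first
    -- one.
    · have hcomm : Commute (compose (M.gates.map Gate.eval)) (Circuit.eval c) := by
        refine compose_commute fun B hB => ?_
        obtain ⟨L', hL', rfl⟩ := List.mem_map.1 hB
        refine compose_commute fun B hB => ?_
        obtain ⟨g, hg, rfl⟩ := List.mem_map.1 hB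
        refine (compose_commute fun B hB => ?_).symm
        obtain ⟨h, hh, rfl⟩ := List.mem_map.1 hB
        exact Gate.eval_commute (hPQ g h (hP.2 L' hL' g hg) (hQ.1 h hh))
      rw [Circuit.eval_cons, Circuit.eval_cons, Circuit.eval_cons, hev, List.map_append,
        compose_append, Matrix.mul_assoc, Matrix.mul_assoc, ← Matrix.mul_assoc (Circuit.eval c),
        ← Matrix.mul_assoc _ (Circuit.eval c)]
      exact congrArg (fun A => Circuit.eval d * (A * _)) hcomm.eq.symm
    · rw [List.forall_mem_cons]
      refine ⟨fun g hg => ?_, hR⟩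
      rcases List.mem_append.1 hg with hg | hg
      · exact Or.inl (hP.1 g hg)
      · exact Or.inr (hQ.1 g hg)

/-! ### A circuit of linear depth for the quantum Fourier transform -/

theorem compose_map_toList_diagonal {ι : Type*} {n : ℕ} (s : Finset ι) (U : ι → Op n)
    (φ : ι → Basis n → ℝ) (h : ∀ i ∈ s, U i = Matrix.diagonal fun x => turn (φ i x)) :
    compose (s.toList.map U) = Matrix.diagonal fun x => turn (∑ i ∈ s, φ i x) := by
  rw [List.map_congr_left fun i hi => h i (Finset.mem_toList.1 hi), compose_diagonal]
  simp only [turn_sum, Finset.prod_map_toList]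

theorem pairwise_map_toList {ι : Type*} {n : ℕ} (s : Finset ι) (g : ι → Gate n)
    (h : ∀ i ∈ s, ∀ j ∈ s, i ≠ j → Disjoint (g i).support (g j).support) :
    (s.toList.map g).Pairwise fun g h => Disjoint g.support h.support := by
  rw [List.pairwise_map]
  exact s.nodup_toList.pairwise_of_forall_ne fun i hi j hj hij =>
    h i (Finset.mem_toList.1 hi) j (Finset.mem_toList.1 hj) hij

/-- The weight of the pair of the output bit `j` and the input bit `k` in the phase of the QFT. -/
def qftWeight (j k : ℕ) : ℝ := 1 / 2 ^ (k - j + 1)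

/-- The controlled phase gates in layer `t` of the QFT. -/
def qftPairs (l t : ℕ) : Finset {p : Fin l × Fin l // p.1 < p.2} :=
  Finset.univ.filter fun p => (p.1.1 : ℕ) + p.1.2 = t

/-- The Hadamard gate, if any, in layer `t` of the QFT. -/
def qftHadamards (l t : ℕ) : Finset (Fin l) := Finset.univ.filter fun j => 2 * (j : ℕ) = t

/-- Layer `t` of the QFT. -/
def qftLayer (l t : ℕ) : List (Gate l) :=
  (qftPairs l t).toList.map
      (fun p => Gate.cphase (2 * Real.pi * qftWeight p.1.1 p.1.2) p.1.1 p.1.2 p.2.ne) ++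
    (qftHadamards l t).toList.map Gate.hadamard

/-- With the index sum `t` fixed, one qubit of a pair determines the other, and the Hadamard gate
sits on the self-paired qubit `t / 2`. -/
theorem qftLayer_pairwise (l t : ℕ) :
    (qftLayer l t).Pairwise fun g h => Disjoint g.support h.support := by
  rw [qftLayer, List.pairwise_append]
  refine ⟨pairwise_map_toList _ _ ?_, pairwise_map_toList _ _ ?_, ?_⟩
  · rintro ⟨⟨j, k⟩, hjk⟩ h ⟨⟨j', k'⟩, hjk'⟩ h' hne
    simp only [qftPairs, Finset.mem_filter, Finset.mem_univ, true_and, Fin.lt_def, ne_eq,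
      Subtype.mk.injEq, Prod.mk.injEq, Fin.ext_iff] at h h' hjk hjk' hne
    simp only [Gate.support, Finset.disjoint_left, Finset.mem_insert, Finset.mem_singleton,
      Fin.ext_iff]
    omega
  · intro i hi j hj hij
    simpa [Gate.support] using hij
  · intro g hg h hh
    simp only [List.mem_map, Finset.mem_toList, qftPairs, qftHadamards, Finset.mem_filter,
      Finset.mem_univ, true_and] at hg hh
    obtain ⟨⟨⟨j, k⟩, hjk⟩, hg, rfl⟩ := hg
    obtain ⟨i, hi, rfl⟩ := hh
    simp only [Fin.lt_def] at hg hjk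
    simp only [Gate.support, Finset.disjoint_left, Finset.mem_insert, Finset.mem_singleton,
      Fin.ext_iff]
    omega

/-- The phase accumulated in the first `t` layers of the QFT. -/
def partialPhase (l t : ℕ) (y x : Basis l) : ℝ :=
  ∑ j : Fin l, ∑ k : Fin l, if j ≤ k ∧ (j : ℕ) + k < t then
    (y j : ℕ) * (x k : ℕ) * qftWeight j k else 0

/-- The phase of the controlled phase gates in layer `t` of the QFT. -/
def layerPhase (l t : ℕ) (y x : Basis l) : ℝ :=
  ∑ j : Fin l, ∑ k : Fin l, if j < k ∧ (j : ℕ) + k = t then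
    (y j : ℕ) * (x k : ℕ) * qftWeight j k else 0

/-- The operator of the first `t` layers of the QFT. -/
def partialQft (l t : ℕ) : Op l := Matrix.of fun y x =>
  if ∀ j : Fin l, t ≤ 2 * (j : ℕ) → y j = x j then
    ((Real.sqrt 2)⁻¹ : ℂ) ^ (Finset.univ.filter fun j : Fin l => 2 * (j : ℕ) < t).card *
      turn (partialPhase l t y x) else 0

theorem partialQft_zero (l : ℕ) : partialQft l 0 = 1 := by
  ext y x
  simp [partialQft, Matrix.one_apply, partialPhase, turn_zero, funext_iff]

theorem qftPairs_eval (l t : ℕ) :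
    compose (((qftPairs l t).toList.map fun p =>
      Gate.cphase (2 * Real.pi * qftWeight p.1.1 p.1.2) p.1.1 p.1.2 p.2.ne).map Gate.eval) =
      Matrix.diagonal fun x => turn (layerPhase l t x x) := by
  rw [List.map_map]
  refine (compose_map_toList_diagonal _ _
    (fun p x => (x p.1.1 : ℕ) * (x p.1.2 : ℕ) * qftWeight p.1.1 p.1.2) fun p _ => ?_).trans ?_
  · exact Gate.eval_cphase (qftWeight p.1.1 p.1.2) p.1.1 p.1.2 p.2.ne
  congr 1
  funext x
  congr 1
  have h := Fintype.sum_prod_type' fun j k : Fin l => if j < k ∧ (j : ℕ) + k = t then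
    ((x j : ℕ) * (x k : ℕ) * qftWeight j k : ℝ) else 0
  rw [layerPhase, ← h]
  simp only [ite_and]
  rw [← Finset.sum_filter, Finset.sum_subtype (p := fun p : Fin l × Fin l => p.1 < p.2) _
    (by simp), qftPairs, Finset.sum_filter]

theorem partialPhase_succ (l t : ℕ) (y x : Basis l) :
    partialPhase l (t + 1) y x = partialPhase l t y x + layerPhase l t y x +
      ∑ j : Fin l, if 2 * (j : ℕ) = t then ((y j : ℕ) * (x j : ℕ) / 2 : ℝ) else 0 := by
  have h : ∑ j : Fin l, (if 2 * (j : ℕ) = t then ((y j : ℕ) * (x j : ℕ) / 2 : ℝ) else 0) =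
      ∑ j : Fin l, ∑ k : Fin l, if j = k ∧ (j : ℕ) + k = t then
        ((y j : ℕ) * (x k : ℕ) * qftWeight j k : ℝ) else 0 := by
    refine Finset.sum_congr rfl fun j _ => ?_
    simp only [ite_and, Finset.sum_ite_eq, Finset.mem_univ, if_true, qftWeight, two_mul]
    simp [div_eq_mul_inv]
  rw [h, partialPhase, partialPhase, layerPhase]
  simp only [← Finset.sum_add_distrib]
  refine Finset.sum_congr rfl fun j _ => Finset.sum_congr rfl fun k _ => ?_
  simp only [Fin.le_def, Fin.lt_def, Fin.ext_iff]
  split_ifs <;> first | omega | simp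

/-- A gate on `j < k` with `j + k = t` has `2j < t < 2k`: qubit `j` has passed its Hadamard gate and
carries an output bit, while qubit `k` still carries its input bit. This is the order of gates that
the QFT requires. -/
theorem qftLayer_mul_partialQft (l t : ℕ) :
    compose ((qftLayer l t).map Gate.eval) * partialQft l t = partialQft l (t + 1) := by
  have hd : Matrix.diagonal (fun x => turn (layerPhase l t x x)) * partialQft l t =
      Matrix.of fun y x => turn (layerPhase l t y x) * partialQft l t y x := by
    ext y x
    rw [Matrix.diagonal_mul, Matrix.of_apply, partialQft, Matrix.of_apply]
    split_ifs with h
    · congr 2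
      refine Finset.sum_congr rfl fun j _ => Finset.sum_congr rfl fun k _ => ?_
      simp only [Fin.lt_def]
      split_ifs with hjk
      · rw [h k (by omega)]
      · rfl
    · simp
  rw [qftLayer, List.map_append, compose_append, qftPairs_eval, Matrix.mul_assoc, hd]
  by_cases ht : ∃ i : Fin l, 2 * (i : ℕ) = t
  · obtain ⟨i, rfl⟩ := ht
    have hH : qftHadamards l (2 * i) = {i} := by
      ext j
      simp [qftHadamards, Fin.ext_iff]
    rw [hH, Finset.toList_singleton, List.map_singleton, List.map_singleton, compose, compose,
      Matrix.one_mul, Gate.eval]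
    ext y x
    -- Before layer `2i` qubit `i` still holds its input value, so a single intermediate string
    -- contributes.
    rw [onQubits_mul_apply (injective_single i), Finset.sum_eq_single fun _ => x i]
    · have hz (j : Fin l) : Function.extend ![i] (fun _ => x i) y j = if j = i then x i else y j := by
        split_ifs with h
        · subst h
          exact (injective_single j).extend_apply _ _ 0
        · exact extend_of_notMem _ _ (by simpa [eq_comm] using h)
      -- Output bit `i` enters neither phase: the pairs involved have `j < k` and `j + k = 2i`, or
      -- `j ≤ k` and `j + k < 2i`, so `j < i` in both cases.
      have hL : layerPhase l (2 * i) (Function.extend ![i] (fun _ => x i) y) x =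
          layerPhase l (2 * i) y x := by
        refine Finset.sum_congr rfl fun j _ => Finset.sum_congr rfl fun k _ => ?_
        simp only [Fin.lt_def, hz]
        split_ifs <;> first | rfl | (exfalso; simp_all; omega)
      have hP : partialPhase l (2 * i) (Function.extend ![i] (fun _ => x i) y) x =
          partialPhase l (2 * i) y x := by
        refine Finset.sum_congr rfl fun j _ => Finset.sum_congr rfl fun k _ => ?_
        simp only [Fin.le_def, hz]
        split_ifs <;> first | rfl | (exfalso; simp_all; omega)
      have hc : (Finset.univ.filter fun j : Fin l => 2 * (j : ℕ) < 2 * i + 1).card =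
          (Finset.univ.filter fun j : Fin l => 2 * (j : ℕ) < 2 * i).card + 1 := by
        rw [← Finset.card_insert_of_notMem (a := i) (by simp)]
        congr 1
        ext j
        simp only [Finset.mem_filter, Finset.mem_univ, true_and, Finset.mem_insert, Fin.ext_iff]
        omega
      have hcond : (∀ j : Fin l, 2 * (i : ℕ) ≤ 2 * (j : ℕ) →
          Function.extend ![i] (fun _ => x i) y j = x j) ↔
          ∀ j : Fin l, 2 * (i : ℕ) + 1 ≤ 2 * (j : ℕ) → y j = x j := by
        refine forall_congr' fun j => ?_
        rw [hz]
        split_ifs with h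
        · subst h
          simp
        · rw [Fin.ext_iff] at h
          exact imp_congr_left (by omega)
      rw [Matrix.of_apply, hL, partialQft, partialQft, Matrix.of_apply, Matrix.of_apply]
      simp only [hcond, hP, hc]
      split_ifs
      · rw [hadamardOp_apply, partialPhase_succ, turn_add, turn_add, Finset.sum_eq_single i]
        · simp
          ring
        · intro j _ hj
          rw [if_neg]
          rw [ne_eq, Fin.ext_iff] at hj
          omega
        · simp
      · simp
    · intro u _ hu
      rw [Matrix.of_apply, partialQft, Matrix.of_apply, if_neg, mul_zero, mul_zero]
      intro h
      refine hu (funext fun a => ?_)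
      rw [← h i le_rfl, Subsingleton.elim a 0]
      exact ((injective_single i).extend_apply u y 0).symm
    · simp
  · have hH : qftHadamards l t = ∅ := by
      simpa [qftHadamards, Finset.filter_eq_empty_iff] using ht
    rw [hH, Finset.toList_empty, List.map_nil, List.map_nil, compose, Matrix.one_mul]
    ext y x
    push Not at ht
    have hcond : (∀ j : Fin l, t ≤ 2 * (j : ℕ) → y j = x j) ↔
        ∀ j : Fin l, t + 1 ≤ 2 * (j : ℕ) → y j = x j := by
      refine forall_congr' fun j => imp_congr_left ?_
      have := ht j
      omega
    have hc : (Finset.univ.filter fun j : Fin l => 2 * (j : ℕ) < t + 1) =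
        (Finset.univ.filter fun j : Fin l => 2 * (j : ℕ) < t) := by
      refine Finset.filter_congr fun j _ => ?_
      have := ht j
      omega
    rw [Matrix.of_apply, partialQft, partialQft, Matrix.of_apply, Matrix.of_apply,
      partialPhase_succ, hc]
    simp only [ht, hcond, if_false, Finset.sum_const_zero, add_zero, turn_add]
    split_ifs
    · ring
    · simp

theorem compose_qftLayers (l t : ℕ) :
    compose ((List.range t).map fun t => compose ((qftLayer l t).map Gate.eval)) =
      partialQft l t := by
  induction t with
  | zero => simp [compose, partialQft_zero]
  | succ t ih =>
    rw [List.range_succ, List.map_append, compose_append, ih, ← qftLayer_mul_partialQft]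
    simp [compose]

theorem turn_congr {s t : ℝ} (k : ℤ) (h : s = t + k) : turn s = turn t := by
  rw [h, turn_add_int]

theorem partialQft_eq_qft {l t : ℕ} (ht : 2 * l ≤ t) : partialQft l t = qft l := by
  ext y x
  rw [partialQft, Matrix.of_apply, qft_apply, if_pos fun j hj => by omega,
    Finset.filter_true_of_mem fun j _ => by omega, Finset.card_univ, Fintype.card_fin]
  congr 1
  · have h : Real.sqrt (2 ^ l) = Real.sqrt 2 ^ l := by
      rw [Real.sqrt_eq_iff_mul_self_eq (by positivity) (by positivity), ← mul_pow,
        Real.mul_self_sqrt (by norm_num)]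
    rw [h, inv_pow, Complex.ofReal_pow]
  · symm
    -- Pairs with `k < j` have no gate: their phase is a multiple of `2 ^ (j - k - 1)`, hence a
    -- whole number of turns.
    refine turn_congr (∑ j : Fin l, ∑ k : Fin l, if k < j then
      ((y j : ℕ) * (x k : ℕ) * 2 ^ ((j : ℕ) - k - 1) : ℤ) else 0) ?_
    rw [msbVal, lsbVal, mul_comm, partialPhase]
    push_cast
    rw [Finset.sum_mul_sum, Finset.sum_div, ← Finset.sum_add_distrib]
    refine Finset.sum_congr rfl fun j _ => ?_
    rw [Finset.sum_div, ← Finset.sum_add_distrib]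
    refine Finset.sum_congr rfl fun k _ => ?_
    have hj := j.2
    have hk := k.2
    by_cases hjk : j ≤ k
    · rw [if_pos ⟨hjk, by omega⟩, if_neg (not_lt.2 hjk), add_zero, qftWeight, div_eq_iff (by positivity)]
      rw [Fin.le_def] at hjk
      have : (2 : ℝ) ^ l = 2 ^ ((k : ℕ) - j + 1) * (2 ^ (j : ℕ) * 2 ^ (l - 1 - (k : ℕ))) := by
        rw [← pow_add, ← pow_add]
        congr 1
        omega
      rw [this]
      field_simp
    · rw [if_neg fun h => hjk h.1, if_pos (not_le.1 hjk), zero_add, div_eq_iff (by positivity)]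
      rw [not_le, Fin.lt_def] at hjk
      have : (2 : ℝ) ^ (j : ℕ) * 2 ^ (l - 1 - (k : ℕ)) = 2 ^ ((j : ℕ) - k - 1) * 2 ^ l := by
        rw [← pow_add, ← pow_add]
        congr 1
        omega
      rw [mul_assoc (_ * _), ← this]
      ring

theorem implementable_qft {l D : ℕ} (hD : 2 * l ≤ D) :
    Implementable D (fun _ => True) (qft l) := by
  have := implementable_of_layers D (fun _ => True) (qftLayer l) (qftLayer_pairwise l) (by simp)
  rwa [compose_qftLayers, partialQft_eq_qft hD] at this

/-- The circuit is a product of unitary gates, so no orthogonality of characters is needed. -/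
theorem qft_mem_unitaryGroup (l : ℕ) : qft l ∈ Matrix.unitaryGroup (Basis l) ℂ :=
  (implementable_qft le_rfl).mem_unitaryGroup

/-! ### Circuits for the block gates -/

theorem blockQubit_val {n m i : ℕ} (k : Fin (blockSize n m i)) :
    (blockQubit n m i k : ℕ) = m * i + k := rfl

theorem blockSize_le (n m i : ℕ) : blockSize n m i ≤ m := min_le_left _ _

theorem blockQubit_div {n m i : ℕ} (k : Fin (blockSize n m i)) :
    (blockQubit n m i k : ℕ) / m = i := by
  have hk := k.2.trans_le (blockSize_le n m i)
  rw [blockQubit_val, Nat.mul_add_div (by omega), Nat.div_eq_of_lt hk, add_zero]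

theorem blockQubit_injective (n m i : ℕ) : Function.Injective (blockQubit n m i) := by
  intro a b h
  have := congrArg Fin.val h
  rw [blockQubit_val, blockQubit_val] at this
  exact Fin.ext (by omega)

theorem mem_range_blockQubit {n m : ℕ} (hm : 0 < m) {i : ℕ} {q : Fin n} :
    q ∈ Set.range (blockQubit n m i) ↔ (q : ℕ) / m = i := by
  constructor
  · rintro ⟨k, rfl⟩
    exact blockQubit_div k
  · intro h
    have h1 := Nat.div_add_mod (q : ℕ) m
    have h2 := Nat.mod_lt (q : ℕ) hm
    have h3 := q.2
    rw [h] at h1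
    refine ⟨⟨(q : ℕ) % m, lt_min h2 (by omega)⟩, Fin.ext ?_⟩
    rw [blockQubit_val]
    exact h1

theorem blockQubit_disjoint {n m i j : ℕ} (h : i ≠ j) :
    Disjoint (Set.range (blockQubit n m i)) (Set.range (blockQubit n m j)) := by
  rw [Set.disjoint_left]
  rintro _ ⟨k, rfl⟩ ⟨l, hl⟩
  have h1 := blockQubit_div k
  rw [← hl, blockQubit_div] at h1
  exact h h1.symm

/-- The gate `g` acts inside the union of the blocks in `B`. -/
def InBlocks (m : ℕ) {n : ℕ} (B : Finset ℕ) (g : Gate n) : Prop :=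
  ∀ q ∈ g.support, (q : ℕ) / m ∈ B

theorem msb_mul_lsb_div {k l : ℕ} (x : Basis k) (y : Basis l) :
    (msbVal x : ℝ) * (lsbVal y : ℝ) / 2 ^ (l + k) =
      ∑ p : Fin l × Fin k,
        (y p.1 : ℕ) * (x p.2 : ℕ) * (2 ^ (p.1 : ℕ) * 2 ^ (k - 1 - (p.2 : ℕ)) / 2 ^ (l + k) : ℝ) := by
  rw [Fintype.sum_prod_type, msbVal, lsbVal, mul_comm]
  push_cast
  rw [Finset.sum_mul_sum, Finset.sum_div]
  refine Finset.sum_congr rfl fun i _ => ?_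
  rw [Finset.sum_div]
  exact Finset.sum_congr rfl fun j _ => by ring

theorem blockPhase_eq (n m i : ℕ) : blockPhase n m i = Matrix.diagonal fun x =>
    turn (msbVal (x ∘ blockQubit n m (i + 1)) * lsbVal (x ∘ blockQubit n m i) /
      2 ^ (blockSize n m i + blockSize n m (i + 1))) := by
  rw [blockPhase]
  congr 1
  funext x
  rw [turn]
  push_cast
  ring_nf

/-- The phase is bilinear in the bits, hence a product of commuting controlled phases over all pairs
`(a, b)` of qubits. Grouping by `a + b` colours the edges of this complete bipartite graph properly,
with fewer than `2m` colours. -/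
theorem implementable_blockPhase (n m i : ℕ) :
    Implementable (2 * m) (InBlocks m {i, i + 1}) (blockPhase n m i) := by
  set l := blockSize n m i
  set k := blockSize n m (i + 1)
  have hne (p : Fin l × Fin k) : blockQubit n m i p.1 ≠ blockQubit n m (i + 1) p.2 := by
    intro h
    have h1 := blockQubit_div p.1
    rw [h, blockQubit_div] at h1
    omega
  let w (p : Fin l × Fin k) : ℝ := 2 ^ (p.1 : ℕ) * 2 ^ (k - 1 - (p.2 : ℕ)) / 2 ^ (l + k)
  let G (p : Fin l × Fin k) : Gate n :=
    Gate.cphase (2 * Real.pi * w p) (blockQubit n m i p.1) (blockQubit n m (i + 1) p.2) (hne p)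
  let s (t : ℕ) : Finset (Fin l × Fin k) := Finset.univ.filter fun p => (p.1 : ℕ) + p.2 = t
  have h := implementable_of_layers (2 * m) (InBlocks m {i, i + 1}) (fun t => (s t).toList.map G)
    ?_ ?_
  · convert h using 1
    have hc (t : ℕ) := compose_map_toList_diagonal (s t) (fun p => (G p).eval)
      (fun p x => (x (blockQubit n m i p.1) : ℕ) * (x (blockQubit n m (i + 1) p.2) : ℕ) * w p)
      fun p _ => Gate.eval_cphase (w p) _ _ (hne p)
    simp only [List.map_map, Function.comp_def, hc]
    rw [compose_diagonal, blockPhase_eq]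
    congr 1
    funext x
    rw [← List.prod_toFinset _ List.nodup_range, List.toFinset_range, ← turn_sum, msb_mul_lsb_div,
      Finset.sum_fiberwise_of_maps_to]
    · rfl
    · intro p _
      have h1 := p.1.2.trans_le (blockSize_le n m i)
      have h2 := p.2.2.trans_le (blockSize_le n m (i + 1))
      rw [Finset.mem_range]
      omega
  · intro t
    refine pairwise_map_toList _ _ ?_
    rintro ⟨a, b⟩ hab ⟨a', b'⟩ hab' hne'
    simp only [s, Finset.mem_filter, Finset.mem_univ, true_and, ne_eq, Prod.mk.injEq,
      Fin.ext_iff] at hab hab' hne'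
    have h1 := fun c => hne (a, c)
    have h2 := fun c => hne (a', c)
    have h3 : a ≠ a' := by
      rw [ne_eq, Fin.ext_iff]
      omega
    have h4 : b ≠ b' := by
      rw [ne_eq, Fin.ext_iff]
      omega
    simp only [G, Gate.support, Finset.disjoint_left, Finset.mem_insert, Finset.mem_singleton]
    rintro _ (rfl | rfl) (h | h)
    · exact h3 (blockQubit_injective _ _ _ h)
    · exact h1 _ h
    · exact h2 _ h.symm
    · exact h4 (blockQubit_injective _ _ _ h)
  · intro t g hg
    obtain ⟨p, -, rfl⟩ := List.mem_map.1 hg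
    intro q hq
    simp only [G, Gate.support, Finset.mem_insert, Finset.mem_singleton] at hq ⊢
    rcases hq with rfl | rfl
    · exact Or.inl (blockQubit_div _)
    · exact Or.inr (blockQubit_div _)

theorem implementable_blockQft (n m i : ℕ) :
    Implementable (2 * m) (InBlocks m {i})
      (onQubits (blockQubit n m i) (qft (blockSize n m i))) := by
  have h := blockSize_le n m i
  refine ((implementable_qft (D := 2 * m) (by omega)).onQubits (blockQubit_injective n m i)).mono
    fun g hg q hq => ?_
  obtain ⟨k, rfl⟩ := hg q hq
  exact Finset.mem_singleton.2 (blockQubit_div k)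

theorem implementable_blockGate (n m : ℕ) (g : BlockGate) :
    Implementable (2 * m) (InBlocks m g.blocks) (g.eval n m) := by
  cases g with
  | qft i => exact implementable_blockQft n m i
  | qftInv i =>
    rw [BlockGate.eval, onQubits_conjTranspose]
    refine (implementable_blockQft n m i).conjTranspose fun g hg q hq => ?_
    exact hg q (by rwa [Gate.inv_support] at hq)
  | phase i => exact implementable_blockPhase n m i

theorem implementable_step (n m : ℕ) (s : List BlockGate)
    (hs : s.Pairwise fun g h => Disjoint g.blocks h.blocks) :
    Implementable (2 * m) (fun g => ∃ b ∈ s, InBlocks m b.blocks g) (stepEval n m s) := by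
  induction s with
  | nil => exact implementable_one _ _
  | cons b s ih =>
    rw [List.pairwise_cons] at hs
    refine ((implementable_blockGate n m b).parallel ?_ (ih hs.2)).mono ?_
    · rintro g h hg ⟨b', hb', hh⟩
      rw [Finset.disjoint_left]
      exact fun q hq hq' => Finset.disjoint_left.1 (hs.1 b' hb') (hg q hq) (hh q hq')
    · rintro g (hg | ⟨b', hb', hg⟩)
      · exact ⟨b, List.mem_cons_self, hg⟩
      · exact ⟨b', List.mem_cons_of_mem _ hb', hg⟩

theorem InBlocks.local {n m : ℕ} {b : BlockGate} {g : Gate n} (h : InBlocks m b.blocks g) :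
    ∀ p ∈ g.support, ∀ q ∈ g.support, (p : ℕ) / m ≤ (q : ℕ) / m + 1 := by
  intro p hp q hq
  have h1 := h p hp
  have h2 := h q hq
  cases b <;> simp only [BlockGate.blocks, Finset.mem_insert, Finset.mem_singleton] at h1 h2 <;>
    omega

theorem exists_circuits (n m : ℕ) (S : List (List BlockGate))
    (hS : ∀ s ∈ S, s.Pairwise fun g h => Disjoint g.blocks h.blocks) :
    ∃ cs : List (Circuit n), List.Forall₂ (fun c s => Circuit.eval c = stepEval n m s) cs S ∧
      Circuit.depth cs.flatten = S.length * (2 * m) ∧ Circuit.IsBlockLocal m cs.flatten := by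
  induction S with
  | nil => exact ⟨[], List.Forall₂.nil, by simp [Circuit.depth], by simp [Circuit.IsBlockLocal]⟩
  | cons s S ih =>
    rw [List.forall_mem_cons] at hS
    obtain ⟨cs, h1, h2, h3⟩ := ih hS.2
    obtain ⟨c, hc1, hc2, hc3⟩ := implementable_step n m s hS.1
    refine ⟨c :: cs, List.Forall₂.cons hc2 h1, ?_, ?_⟩
    · simp only [Circuit.depth] at h2 hc1 ⊢
      rw [List.flatten_cons, List.length_append, h2, hc1, List.length_cons]
      ring
    · intro L hL
      rw [List.flatten_cons, List.mem_append] at hL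
      rcases hL with hL | hL
      · intro g hg
        obtain ⟨b, -, hb⟩ := hc3 L hL g hg
        exact hb.local
      · exact h3 L hL

/-! ### Disjointness of the gates within each step -/

theorem mem_evens {N i : ℕ} : i ∈ evens N ↔ i < N ∧ i % 2 = 0 := by simp [evens]

theorem mem_odds {N i : ℕ} : i ∈ odds N ↔ i < N ∧ i % 2 = 1 := by simp [odds]

theorem nodup_evens (N : ℕ) : (evens N).Nodup := List.nodup_range.filter _

theorem nodup_odds (N : ℕ) : (odds N).Nodup := List.nodup_range.filter _

theorem pairwise_map_of_nodup {l : List ℕ} (hl : l.Nodup) (G : ℕ → BlockGate)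
    (h : ∀ i ∈ l, ∀ j ∈ l, i ≠ j → Disjoint (G i).blocks (G j).blocks) :
    (l.map G).Pairwise fun g h => Disjoint g.blocks h.blocks := by
  rw [List.pairwise_map]
  exact hl.pairwise_of_forall_ne fun i hi j hj => h i hi j hj

theorem oqft_pairwise (n m : ℕ) :
    ∀ s ∈ oqft n m, s.Pairwise fun g h => Disjoint g.blocks h.blocks := by
  intro s hs
  simp only [oqft, List.mem_cons, List.not_mem_nil, or_false] at hs
  rcases hs with rfl | rfl | rfl | rfl | rfl
  · exact pairwise_map_of_nodup (nodup_evens _) _ fun i _ j _ h => by simpa [BlockGate.blocks] using h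
  · refine pairwise_map_of_nodup (nodup_evens _) _ fun i hi j hj h => ?_
    rw [mem_evens] at hi hj
    simp only [BlockGate.blocks, Finset.disjoint_left, Finset.mem_insert, Finset.mem_singleton]
    omega
  · rw [List.pairwise_append]
    refine ⟨pairwise_map_of_nodup (nodup_odds _) _ fun i _ j _ h => ?_,
      pairwise_map_of_nodup (nodup_evens _) _ fun i _ j _ h => ?_, ?_⟩
    · simpa [BlockGate.blocks] using h
    · simpa [BlockGate.blocks] using h
    · intro g hg h hh
      obtain ⟨i, hi, rfl⟩ := List.mem_map.1 hg
      obtain ⟨j, hj, rfl⟩ := List.mem_map.1 hh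
      rw [mem_odds] at hi
      rw [mem_evens] at hj
      simp only [BlockGate.blocks, Finset.disjoint_left, Finset.mem_singleton]
      omega
  · refine pairwise_map_of_nodup (nodup_odds _) _ fun i hi j hj h => ?_
    rw [mem_odds] at hi hj
    simp only [BlockGate.blocks, Finset.disjoint_left, Finset.mem_insert, Finset.mem_singleton]
    omega
  · exact pairwise_map_of_nodup (nodup_evens _) _ fun i _ j _ h => by simpa [BlockGate.blocks] using h

theorem blockEval_mem_unitaryGroup (n m : ℕ) :
    blockEval n m (oqft n m) ∈ Matrix.unitaryGroup (Basis n) ℂ := by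
  refine compose_mem_unitaryGroup fun U hU => ?_
  obtain ⟨s, hs, rfl⟩ := List.mem_map.1 hU
  exact (implementable_step n m s (oqft_pairwise n m s hs)).mem_unitaryGroup

/-! ### Sums over the values of a register -/

theorem lsbVal_eq {l : ℕ} (y : Basis l) : lsbVal y = (finFunctionFinEquiv y : ℕ) := by
  rw [finFunctionFinEquiv_apply, lsbVal]

theorem msbVal_eq {l : ℕ} (x : Basis l) : msbVal x = lsbVal (x ∘ Fin.rev) := by
  rw [msbVal, lsbVal, ← Equiv.sum_comp Fin.revPerm]
  refine Finset.sum_congr rfl fun k _ => ?_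
  rw [Fin.revPerm_apply, Function.comp_apply, Fin.val_rev]
  congr 2
  omega

theorem lsbVal_lt {l : ℕ} (y : Basis l) : lsbVal y < 2 ^ l := by
  rw [lsbVal_eq]
  exact Fin.is_lt _

theorem msbVal_lt {l : ℕ} (x : Basis l) : msbVal x < 2 ^ l := by
  rw [msbVal_eq]
  exact lsbVal_lt _

theorem sum_lsbVal {E : Type*} [AddCommMonoid E] (l : ℕ) (f : ℕ → E) :
    ∑ y : Basis l, f (lsbVal y) = ∑ k ∈ Finset.range (2 ^ l), f k := by
  simp only [lsbVal_eq]
  rw [Finset.sum_range, finFunctionFinEquiv.sum_comp fun k => f (k : ℕ)]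

theorem sum_msbVal {E : Type*} [AddCommMonoid E] (l : ℕ) (f : ℕ → E) :
    ∑ x : Basis l, f (msbVal x) = ∑ k ∈ Finset.range (2 ^ l), f k := by
  simp only [msbVal_eq]
  rw [← sum_lsbVal]
  exact (Fin.revPerm.arrowCongr (Equiv.refl (Fin 2))).sum_comp fun y : Basis l => f (lsbVal y)

/-! ### Phase rotations by a fraction of a unit before and after a Fourier transform -/

/-- The kernel of the translation by the fraction `b` of a unit on `ℤ / M`. -/
def fracShift (M : ℕ) (b : ℝ) (d : ℤ) : ℂ :=
  (M : ℂ)⁻¹ * ∑ k ∈ Finset.range M, turn (k * ((b - d) / M))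

theorem fracShift_add_self {M : ℕ} (hM : 0 < M) (b : ℝ) (d : ℤ) :
    fracShift M b (d + M) = fracShift M b d := by
  rw [fracShift, fracShift]
  congr 1
  refine Finset.sum_congr rfl fun k _ => turn_congr (-k) ?_
  have : (M : ℝ) ≠ 0 := by positivity
  push_cast
  field_simp
  ring

/-- The kernel is a geometric sum; multiplied by one minus its ratio it telescopes to a difference
of two phases over `M`. -/
theorem norm_fracShift_mul_le (M : ℕ) (b : ℝ) (d : ℤ) :
    ‖fracShift M b d‖ * ‖1 - turn ((b - d) / M)‖ ≤ 2 / M := by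
  simp only [fracShift, turn_nat_mul]
  rw [← norm_mul, mul_assoc, geom_sum_mul_neg, ← turn_nat_mul, norm_mul, norm_inv,
    Complex.norm_natCast, inv_mul_eq_div]
  gcongr
  refine (norm_sub_le _ _).trans ?_
  rw [norm_turn, norm_one]
  norm_num

/-- The chord has length `2 sin (π u)`, and Jordan's inequality applies on each half of the
interval. With `u = d / M` this dominates the weight `d (M - d)` of `sum_periodic_mul_abs`. -/
theorem four_mul_le_norm_one_sub_turn {u : ℝ} (h0 : 0 ≤ u) (h1 : u ≤ 1) :
    4 * (u * (1 - u)) ≤ ‖1 - turn u‖ := by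
  have key : ∀ v : ℝ, 0 ≤ v → v ≤ 1 / 2 → 2 * (v * (1 - v)) ≤ Real.sin (Real.pi * v) := by
    intro v hv hv'
    have h := Real.mul_le_sin (x := Real.pi * v) (by positivity) (by nlinarith [Real.pi_pos])
    have h2 : 2 / Real.pi * (Real.pi * v) = 2 * v := by
      field_simp
    nlinarith
  have hs : 2 * (u * (1 - u)) ≤ Real.sin (Real.pi * u) := by
    rcases le_total u (1 / 2) with h | h
    · exact key u h0 h
    · have := key (1 - u) (by linarith) (by linarith)
      rw [mul_sub Real.pi, mul_one, Real.sin_pi_sub] at this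
      linarith
  rw [norm_sub_rev, turn, mul_comm _ Complex.I, Complex.norm_exp_I_mul_ofReal_sub_one, norm_mul,
    Real.norm_eq_abs, Real.norm_eq_abs, show 2 * Real.pi * u / 2 = Real.pi * u by ring]
  have := le_abs_self (Real.sin (Real.pi * u))
  rw [abs_of_pos (by norm_num : (0 : ℝ) < 2)]
  linarith

theorem norm_one_sub_turn_sub_le (s t : ℝ) :
    ‖1 - turn s‖ ≤ ‖1 - turn (t - s)‖ + ‖1 - turn t‖ := by
  have h : 1 - turn s = turn s * -(1 - turn (t - s)) + (1 - turn t) * 1 := by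
    have : turn t = turn s * turn (t - s) := by rw [← turn_add, add_sub_cancel]
    rw [this]
    ring
  rw [h]
  refine (norm_add_le _ _).trans ?_
  rw [norm_mul, norm_turn, norm_neg, one_mul, mul_one]

/-- One of the two factors `‖fracShift M b d‖` is spent against the chord at `b - d`, leaving `2 /
M`; the other sums to at most `√M` by Cauchy–Schwarz. Replacing the chord at `b - d` by the one at
`d` costs at most `2π / M`. -/
theorem sum_fracShift_mul_le {M : ℕ} (hM : 0 < M) {b : ℝ} (hb0 : 0 ≤ b) (hb1 : b ≤ 1)
    (h : ∑ d ∈ Finset.range M, ‖fracShift M b d‖ ^ 2 = 1) :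
    ∑ d ∈ Finset.range M, ‖fracShift M b d‖ ^ 2 * ‖1 - turn (d / M)‖ ≤
      2 / Real.sqrt M + 2 * Real.pi / M := by
  have hM' : (0 : ℝ) < M := by positivity
  have h1 : ∑ d ∈ Finset.range M, ‖fracShift M b d‖ ≤ Real.sqrt M := by
    refine Real.le_sqrt_of_sq_le ?_
    refine sq_sum_le_card_mul_sum_sq.trans ?_
    rw [h, Finset.card_range, mul_one]
  calc ∑ d ∈ Finset.range M, ‖fracShift M b d‖ ^ 2 * ‖1 - turn (d / M)‖
      ≤ ∑ d ∈ Finset.range M, (‖fracShift M b d‖ * (2 / M) +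
          ‖fracShift M b d‖ ^ 2 * (2 * Real.pi / M)) := by
        refine Finset.sum_le_sum fun d _ => ?_
        have h2 := norm_fracShift_mul_le M b d
        have h3 := norm_one_sub_turn_sub_le (d / M) (b / M)
        have h4 := norm_one_sub_turn_le (b / M)
        have h5 : 2 * Real.pi * |b / M| ≤ 2 * Real.pi / M := by
          rw [abs_of_nonneg (by positivity), ← mul_div_assoc]
          exact div_le_div_of_nonneg_right (mul_le_of_le_one_right (by positivity) hb1) hM'.le
        rw [← sub_div] at h3
        rw [Int.cast_natCast] at h2
        have h0 := norm_nonneg (fracShift M b d)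
        calc ‖fracShift M b d‖ ^ 2 * ‖1 - turn (d / M)‖
            ≤ ‖fracShift M b d‖ ^ 2 * (‖1 - turn ((b - d) / M)‖ + 2 * Real.pi / M) := by
              gcongr
              linarith
          _ = ‖fracShift M b d‖ * (‖fracShift M b d‖ * ‖1 - turn ((b - d) / M)‖) +
              ‖fracShift M b d‖ ^ 2 * (2 * Real.pi / M) := by ring
          _ ≤ _ := by gcongr
    _ = (∑ d ∈ Finset.range M, ‖fracShift M b d‖) * (2 / M) + 2 * Real.pi / M := by
        rw [Finset.sum_add_distrib, ← Finset.sum_mul, ← Finset.sum_mul, h, one_mul]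
    _ ≤ Real.sqrt M * (2 / M) + 2 * Real.pi / M := by gcongr
    _ = _ := by
        congr 1
        have := Real.mul_self_sqrt hM'.le
        have h6 : 0 < Real.sqrt M := Real.sqrt_pos.2 hM'
        field_simp
        nlinarith

/-- Among the pairs with `z - x ≡ d` modulo `M`, there are `M - d` at distance `d` and `d` wrapped
ones at distance `M - d`. The rare wraparound is thus weighed by its frequency. -/
theorem sum_periodic_mul_abs {M : ℕ} (φ : ℤ → ℝ) (hφ : ∀ d, φ (d + M) = φ d) :
    ∑ x ∈ Finset.range M, ∑ z ∈ Finset.range M, φ (z - x) * |(z - x : ℝ)| =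
      ∑ d ∈ Finset.range M, φ d * (2 * (d * (M - d))) := by
  have h (x : ℕ) (hx : x ∈ Finset.range M) :
      ∑ z ∈ Finset.range M, φ (z - x) * |(z - x : ℝ)| =
        ∑ d ∈ Finset.range M, φ d * (if x < M - d then (d : ℝ) else M - d) := by
    rw [Finset.mem_range] at hx
    -- Substitution of the residue of `z - x` modulo `M` for `z`.
    refine Finset.sum_nbij' (fun z => if x ≤ z then z - x else z + M - x)
      (fun d => if x < M - d then d + x else d + x - M) ?_ ?_ ?_ ?_ ?_
    · intro z hz
      rw [Finset.mem_range] at hz ⊢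
      split_ifs <;> omega
    · intro z hz
      rw [Finset.mem_range] at hz ⊢
      split_ifs <;> omega
    · intro z hz
      rw [Finset.mem_range] at hz
      split_ifs <;> omega
    · intro z hz
      rw [Finset.mem_range] at hz
      split_ifs <;> omega
    · intro z hz
      rw [Finset.mem_range] at hz
      by_cases hxz : x ≤ z
      · have hxz' : (x : ℝ) ≤ z := by exact_mod_cast hxz
        simp only [if_pos hxz]
        rw [if_pos (by omega), Nat.cast_sub hxz, abs_of_nonneg (by linarith), Nat.cast_sub hxz]
      · have hxz' : (z : ℝ) ≤ x := by exact_mod_cast (not_le.1 hxz).le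
        have hle : x ≤ z + M := by omega
        simp only [if_neg hxz]
        rw [if_neg (by omega), Nat.cast_sub hle, ← hφ, abs_of_nonpos (by linarith),
          Nat.cast_sub hle]
        push_cast
        congr 1
        · congr 1
          ring
        · ring
  rw [Finset.sum_congr rfl h, Finset.sum_comm]
  refine Finset.sum_congr rfl fun d hd => ?_
  rw [Finset.mem_range] at hd
  rw [← Finset.mul_sum, Finset.sum_ite, Finset.sum_const, Finset.sum_const]
  have h1 : (Finset.range M).filter (fun x => x < M - d) = Finset.range (M - d) := by
    ext x
    simp only [Finset.mem_filter, Finset.mem_range]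
    omega
  have h2 : (Finset.range M).filter (fun x => ¬ x < M - d) = Finset.Ico (M - d) M := by
    ext x
    simp only [Finset.mem_filter, Finset.mem_range, Finset.mem_Ico]
    omega
  rw [h1, h2, Finset.card_range, Nat.card_Ico, Nat.sub_sub_self hd.le, nsmul_eq_mul, nsmul_eq_mul,
    Nat.cast_sub hd.le]
  ring

theorem sum_fracShift_mul_abs_le {M : ℕ} (hM : 0 < M) {b : ℝ} (hb0 : 0 ≤ b) (hb1 : b ≤ 1)
    (h : ∑ d ∈ Finset.range M, ‖fracShift M b d‖ ^ 2 = 1) :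
    ∑ x ∈ Finset.range M, ∑ z ∈ Finset.range M,
      ‖fracShift M b (z - x)‖ ^ 2 * |(z - x : ℝ)| ≤
        M ^ 2 / 2 * (2 / Real.sqrt M + 2 * Real.pi / M) := by
  have hM' : (0 : ℝ) < M := by positivity
  rw [sum_periodic_mul_abs (fun d => ‖fracShift M b d‖ ^ 2)
    fun d => by simp only [fracShift_add_self hM]]
  refine le_trans ?_ (mul_le_mul_of_nonneg_left (sum_fracShift_mul_le hM hb0 hb1 h) (by positivity))
  rw [Finset.mul_sum]
  refine Finset.sum_le_sum fun d hd => ?_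
  rw [Finset.mem_range] at hd
  have hd' : (d : ℝ) ≤ M := by exact_mod_cast hd.le
  have h1 := four_mul_le_norm_one_sub_turn (u := d / M) (by positivity)
    (by rw [div_le_one hM']; exact hd')
  have h2 : (2 * (d * (M - d)) : ℝ) = M ^ 2 / 2 * (4 * (d / M * (1 - d / M))) := by
    field_simp
    ring
  rw [h2, mul_left_comm]
  gcongr

/-- The phase rotation by the fraction `a` of a unit, read with the first qubit most significant. -/
def msbRotation (l : ℕ) (a : ℝ) : Op l :=
  Matrix.diagonal fun x => turn (a * msbVal x / 2 ^ l)

/-- The phase rotation by the fraction `b` of a unit, read with the first qubit least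
significant. -/
def lsbRotation (l : ℕ) (b : ℝ) : Op l :=
  Matrix.diagonal fun y => turn (b * lsbVal y / 2 ^ l)

/-- The QFT with a phase rotation before and after it. -/
def rotatedQft (l : ℕ) (a b : ℝ) : Op l := lsbRotation l b * qft l * msbRotation l a

/-- The operator by which the optimistic QFT replaces `rotatedQft l a b` on a block. -/
def optimisticBlock (l : ℕ) (a b : ℝ) : Op l :=
  qft l * (msbRotation l a * ((qft l)ᴴ * (lsbRotation l b * qft l)))

/-- The normalized overlap of `rotatedQft l a b` and `optimisticBlock l a b`. -/
def blockOverlap (l : ℕ) (a b : ℝ) : ℂ :=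
  (2 ^ l : ℂ)⁻¹ * Matrix.trace ((rotatedQft l a b)ᴴ * optimisticBlock l a b)

theorem qft_conjTranspose_mul_self (l : ℕ) : (qft l)ᴴ * qft l = 1 :=
  Matrix.mem_unitaryGroup_iff'.1 (qft_mem_unitaryGroup l)

theorem qft_mul_conjTranspose_self (l : ℕ) : qft l * (qft l)ᴴ = 1 :=
  Matrix.mem_unitaryGroup_iff.1 (qft_mem_unitaryGroup l)

theorem lsbRotation_conjTranspose_mul_self (l : ℕ) (b : ℝ) :
    (lsbRotation l b)ᴴ * lsbRotation l b = 1 := by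
  rw [lsbRotation, Matrix.diagonal_conjTranspose, Matrix.diagonal_mul_diagonal,
    ← Matrix.diagonal_one]
  congr 1
  funext x
  exact star_turn_mul_self _

theorem star_inv_sqrt (l : ℕ) : star ((Real.sqrt (2 ^ l))⁻¹ : ℂ) = ((Real.sqrt (2 ^ l))⁻¹ : ℂ) := by
  rw [← Complex.ofReal_inv, Complex.star_def, Complex.conj_ofReal]

theorem inv_sqrt_mul_self (l : ℕ) :
    ((Real.sqrt (2 ^ l))⁻¹ : ℂ) * ((Real.sqrt (2 ^ l))⁻¹ : ℂ) = (2 ^ l : ℂ)⁻¹ := by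
  rw [← mul_inv, ← Complex.ofReal_mul, Real.mul_self_sqrt (by positivity)]
  push_cast
  rfl

/-- A rotation on the Fourier side is a translation: this is the matrix `T_b`, whose entries depend
only on the difference of the two values. -/
theorem qft_conjugate_lsbRotation_apply (l : ℕ) (b : ℝ) (z x : Basis l) :
    ((qft l)ᴴ * (lsbRotation l b * qft l)) z x =
      fracShift (2 ^ l) b ((msbVal z : ℤ) - msbVal x) := by
  rw [Matrix.mul_apply, fracShift, ← sum_lsbVal, Finset.mul_sum]
  refine Finset.sum_congr rfl fun w _ => ?_
  have ht : turn (lsbVal w * ((b - ((msbVal z : ℤ) - msbVal x : ℤ)) / (2 ^ l : ℕ))) =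
      turn (-(msbVal z * lsbVal w / 2 ^ l)) *
        (turn (b * lsbVal w / 2 ^ l) * turn (msbVal x * lsbVal w / 2 ^ l)) := by
    rw [← turn_add, ← turn_add]
    push_cast
    congr 1
    ring
  rw [Matrix.conjTranspose_apply, lsbRotation, Matrix.diagonal_mul, qft_apply, qft_apply, star_mul',
    star_inv_sqrt, star_turn, ht]
  push_cast
  linear_combination (turn (-(msbVal z * lsbVal w / 2 ^ l)) *
    (turn (b * lsbVal w / 2 ^ l) * turn (msbVal x * lsbVal w / 2 ^ l))) * inv_sqrt_mul_self l

theorem conjTranspose_rotatedQft_mul_optimisticBlock (l : ℕ) (a b : ℝ) :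
    (rotatedQft l a b)ᴴ * optimisticBlock l a b =
      (msbRotation l a)ᴴ * (((qft l)ᴴ * (lsbRotation l b * qft l))ᴴ *
        (msbRotation l a * ((qft l)ᴴ * (lsbRotation l b * qft l)))) := by
  simp only [rotatedQft, optimisticBlock, Matrix.conjTranspose_mul,
    Matrix.conjTranspose_conjTranspose, Matrix.mul_assoc]

/-- The outer QFT cancels and leaves the trace of the commutator `R_a† T_b† R_a T_b`. As `R_a` is
diagonal, this is an average of phases with weights `|T_b(z, x)|²`. -/
theorem blockOverlap_eq (l : ℕ) (a b : ℝ) :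
    blockOverlap l a b = (2 ^ l : ℂ)⁻¹ * ∑ x ∈ Finset.range (2 ^ l), ∑ z ∈ Finset.range (2 ^ l),
      (‖fracShift (2 ^ l) b (z - x)‖ ^ 2 : ℝ) * turn (a * (z - x) / 2 ^ l) := by
  rw [blockOverlap, conjTranspose_rotatedQft_mul_optimisticBlock, Matrix.trace, ← sum_msbVal]
  congr 1
  refine Finset.sum_congr rfl fun x _ => ?_
  rw [Matrix.diag_apply, ← sum_msbVal l fun z =>
    ((‖fracShift (2 ^ l) b (z - msbVal x)‖ ^ 2 : ℝ) : ℂ) * turn (a * (z - msbVal x) / 2 ^ l)]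
  rw [msbRotation, Matrix.diagonal_conjTranspose, Matrix.diagonal_mul, Matrix.mul_apply,
    Finset.mul_sum]
  refine Finset.sum_congr rfl fun z _ => ?_
  rw [Matrix.conjTranspose_apply, Matrix.diagonal_mul, qft_conjugate_lsbRotation_apply,
    Pi.star_apply, star_turn]
  have h (w : ℂ) : ((‖w‖ ^ 2 : ℝ) : ℂ) = star w * w := by
    rw [Complex.star_def, mul_comm, Complex.mul_conj, Complex.normSq_eq_norm_sq]
  have ht : turn (a * ((msbVal z : ℝ) - msbVal x) / 2 ^ l) =
      turn (-(a * msbVal x / 2 ^ l)) * turn (a * msbVal z / 2 ^ l) := by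
    rw [← turn_add]
    congr 1
    ring
  rw [h, ht]
  ring

/-- These are the squared entries of a column of the unitary matrix `T_b`. -/
theorem sum_sq_norm_fracShift (l : ℕ) (b : ℝ) (x : Basis l) :
    ∑ z ∈ Finset.range (2 ^ l), ‖fracShift (2 ^ l) b (z - msbVal x)‖ ^ 2 = 1 := by
  have hU : ((qft l)ᴴ * (lsbRotation l b * qft l))ᴴ * ((qft l)ᴴ * (lsbRotation l b * qft l)) = 1 := by
    have h1 := qft_mul_conjTranspose_self l
    have h2 := lsbRotation_conjTranspose_mul_self l b
    have h3 := qft_conjTranspose_mul_self l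
    calc _ = (qft l)ᴴ * ((lsbRotation l b)ᴴ * ((qft l * (qft l)ᴴ) * lsbRotation l b)) * qft l := by
          simp only [Matrix.conjTranspose_mul, Matrix.conjTranspose_conjTranspose, Matrix.mul_assoc]
      _ = 1 := by rw [h1, Matrix.one_mul, h2, Matrix.mul_one, h3]
  have h := congrFun (congrFun hU x) x
  rw [Matrix.mul_apply, Matrix.one_apply_eq] at h
  rw [← sum_msbVal l fun z => ‖fracShift (2 ^ l) b (z - msbVal x)‖ ^ 2]
  rw [← Complex.ofReal_inj, Complex.ofReal_sum, Complex.ofReal_one, ← h]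
  refine Finset.sum_congr rfl fun z _ => ?_
  rw [Matrix.conjTranspose_apply, qft_conjugate_lsbRotation_apply, Complex.star_def, mul_comm,
    Complex.mul_conj, Complex.normSq_eq_norm_sq]

theorem sum_sum_sq_norm_fracShift (l : ℕ) (b : ℝ) :
    ∑ x ∈ Finset.range (2 ^ l), ∑ z ∈ Finset.range (2 ^ l), ‖fracShift (2 ^ l) b (z - x)‖ ^ 2 =
      2 ^ l := by
  rw [← sum_msbVal l fun x => ∑ z ∈ Finset.range (2 ^ l), ‖fracShift (2 ^ l) b (z - x)‖ ^ 2]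
  simp [sum_sq_norm_fracShift]

theorem norm_blockOverlap_le_one (l : ℕ) (a b : ℝ) : ‖blockOverlap l a b‖ ≤ 1 := by
  rw [blockOverlap_eq, norm_mul, norm_inv, norm_pow, Complex.norm_ofNat, inv_mul_le_iff₀ (by positivity),
    mul_one, ← sum_sum_sq_norm_fracShift l b]
  refine (norm_sum_le _ _).trans (Finset.sum_le_sum fun x _ => ?_)
  refine (norm_sum_le _ _).trans (Finset.sum_le_sum fun z _ => ?_)
  rw [norm_mul, norm_turn, mul_one, Complex.norm_real, Real.norm_of_nonneg (by positivity)]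

/-- `T_0` is the identity. This disposes of the last block, which has no right neighbour and may be
too short for the general estimate. -/
theorem blockOverlap_zero_right (l : ℕ) (a : ℝ) : blockOverlap l a 0 = 1 := by
  have h : lsbRotation l 0 = 1 := by
    simp [lsbRotation, turn_zero]
  have h2 : (msbRotation l a)ᴴ * msbRotation l a = 1 := by
    rw [msbRotation, Matrix.diagonal_conjTranspose, Matrix.diagonal_mul_diagonal,
      ← Matrix.diagonal_one]
    congr 1
    funext x
    exact star_turn_mul_self _
  rw [blockOverlap, conjTranspose_rotatedQft_mul_optimisticBlock, h, Matrix.one_mul,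
    qft_conjTranspose_mul_self, Matrix.conjTranspose_one, Matrix.one_mul, Matrix.mul_one, h2,
    Matrix.trace_one, Fintype.card_fun, Fintype.card_fin, Fintype.card_fin]
  push_cast
  exact inv_mul_cancel₀ (pow_ne_zero _ two_ne_zero)

/-- The weights sum to `2 ^ l`, so only the deviation of each phase from `1` counts; it is at most
`2π |z - x| / 2 ^ l`, and `sum_fracShift_mul_abs_le` bounds the weighted distance. -/
theorem norm_one_sub_blockOverlap_le (l : ℕ) {a b : ℝ} (ha0 : 0 ≤ a) (ha1 : a ≤ 1) (hb0 : 0 ≤ b)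
    (hb1 : b ≤ 1) : ‖1 - blockOverlap l a b‖ ≤ 30 / Real.sqrt (2 ^ l) := by
  have hM : (0 : ℝ) < 2 ^ l := by positivity
  have h1 : 1 - blockOverlap l a b = (2 ^ l : ℂ)⁻¹ * ∑ x ∈ Finset.range (2 ^ l),
      ∑ z ∈ Finset.range (2 ^ l),
        (‖fracShift (2 ^ l) b (z - x)‖ ^ 2 : ℝ) * (1 - turn (a * (z - x) / 2 ^ l)) := by
    have h := congrArg (fun r : ℝ => (2 ^ l : ℂ)⁻¹ * r) (sum_sum_sq_norm_fracShift l b)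
    simp only [Complex.ofReal_sum] at h
    rw [Complex.ofReal_pow, Complex.ofReal_ofNat, inv_mul_cancel₀ (pow_ne_zero _ two_ne_zero)] at h
    rw [blockOverlap_eq]
    refine (congrArg (· - _) h.symm).trans ?_
    simp only [← mul_sub, ← Finset.sum_sub_distrib, mul_one_sub]
  -- The required normalization is the one of the column at the zero string.
  have h2 := sum_fracShift_mul_abs_le (M := 2 ^ l) (by positivity) hb0 hb1
    (by simpa [msbVal] using sum_sq_norm_fracShift l b fun _ => 0)
  push_cast at h2
  have h3 : ‖1 - blockOverlap l a b‖ ≤ (2 ^ l : ℝ)⁻¹ * (2 * Real.pi / 2 ^ l *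
      ((2 ^ l) ^ 2 / 2 * (2 / Real.sqrt (2 ^ l) + 2 * Real.pi / 2 ^ l))) := by
    rw [h1, norm_mul, norm_inv, norm_pow, Complex.norm_ofNat]
    gcongr
    refine le_trans ?_ (mul_le_mul_of_nonneg_left h2 (by positivity))
    rw [Finset.mul_sum]
    refine (norm_sum_le _ _).trans (Finset.sum_le_sum fun x _ => ?_)
    rw [Finset.mul_sum]
    refine (norm_sum_le _ _).trans (Finset.sum_le_sum fun z _ => ?_)
    rw [norm_mul, Complex.norm_real, Real.norm_of_nonneg (by positivity), mul_left_comm]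
    gcongr
    refine (norm_one_sub_turn_le _).trans ?_
    rw [abs_div, abs_mul, abs_of_nonneg ha0, abs_of_pos hM, mul_div_assoc', div_mul_eq_mul_div]
    gcongr
    exact mul_le_of_le_one_left (abs_nonneg _) ha1
  refine h3.trans ?_
  have h4 : (2 ^ l : ℝ)⁻¹ * (2 * Real.pi / 2 ^ l *
      ((2 ^ l) ^ 2 / 2 * (2 / Real.sqrt (2 ^ l) + 2 * Real.pi / 2 ^ l))) =
      Real.pi * (2 / Real.sqrt (2 ^ l) + 2 * Real.pi / 2 ^ l) := by
    field_simp
  rw [h4]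
  have h5 : (1 : ℝ) ≤ Real.sqrt (2 ^ l) := by
    rw [Real.one_le_sqrt]
    exact one_le_pow₀ (by norm_num)
  have h6 : 2 * Real.pi / 2 ^ l ≤ 2 * Real.pi / Real.sqrt (2 ^ l) := by
    gcongr
    calc Real.sqrt (2 ^ l) ≤ Real.sqrt (2 ^ l) * Real.sqrt (2 ^ l) := by nlinarith
      _ = 2 ^ l := Real.mul_self_sqrt hM.le
  -- The constant is `π (2 + 2π)`, below `26.2` for `π < 3.15`.
  have hpi := Real.pi_lt_d2
  have hpi0 := Real.pi_pos
  calc Real.pi * (2 / Real.sqrt (2 ^ l) + 2 * Real.pi / 2 ^ l)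
      ≤ Real.pi * (2 / Real.sqrt (2 ^ l) + 2 * Real.pi / Real.sqrt (2 ^ l)) := by gcongr
    _ = Real.pi * (2 + 2 * Real.pi) / Real.sqrt (2 ^ l) := by ring
    _ ≤ 30 / Real.sqrt (2 ^ l) := by
      gcongr
      nlinarith

/-! ### Tensor products of block operators -/

/-- The tensor product of operators on the blocks `0, …, N - 1`. -/
def blockTensor (n m N : ℕ) (A : ∀ i : Fin N, Op (blockSize n m i)) : Op n := Matrix.of fun y x =>
  ∏ i : Fin N, A i (y ∘ blockQubit n m i) (x ∘ blockQubit n m i)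

theorem div_lt_of_le_mul {n m N : ℕ} (hN : n ≤ m * N) (q : Fin n) : (q : ℕ) / m < N :=
  Nat.div_lt_of_lt_mul (q.2.trans_le hN)

theorem blockQubit_bijective {n m N : ℕ} (hm : 0 < m) (hN : n ≤ m * N) :
    Function.Bijective fun p : (i : Fin N) × Fin (blockSize n m i) => blockQubit n m p.1 p.2 := by
  constructor
  · rintro ⟨i, k⟩ ⟨j, l⟩ h
    have h1 := blockQubit_div k
    have h2 := blockQubit_div l
    simp only at h
    rw [h, h2] at h1
    obtain rfl : j = i := Fin.ext h1
    rw [blockQubit_injective _ _ _ h]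
  · intro q
    obtain ⟨k, hk⟩ := (mem_range_blockQubit hm (q := q)).2 rfl
    exact ⟨⟨⟨(q : ℕ) / m, div_lt_of_le_mul hN q⟩, k⟩, hk⟩

theorem ext_blocks {n m N : ℕ} (hm : 0 < m) (hN : n ≤ m * N) {x y : Basis n}
    (h : ∀ i : Fin N, y ∘ blockQubit n m i = x ∘ blockQubit n m i) : y = x := by
  funext q
  obtain ⟨⟨i, k⟩, rfl⟩ := (blockQubit_bijective hm hN).2 q
  exact congrFun (h i) k

theorem sum_prod_blocks {n m N : ℕ} (hm : 0 < m) (hN : n ≤ m * N)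
    (f : ∀ i : Fin N, Basis (blockSize n m i) → ℂ) :
    ∑ x : Basis n, ∏ i, f i (x ∘ blockQubit n m i) = ∏ i, ∑ u, f i u := by
  rw [Finset.prod_univ_sum, Fintype.piFinset_univ]
  let e : Basis n ≃ ∀ i : Fin N, Basis (blockSize n m i) :=
    ((Equiv.ofBijective _ (blockQubit_bijective hm hN)).symm.arrowCongr (Equiv.refl _)).trans
      (Equiv.piCurry fun _ _ => Fin 2)
  exact e.sum_comp fun p => ∏ i, f i (p i)

theorem blockTensor_mul {n m N : ℕ} (hm : 0 < m) (hN : n ≤ m * N)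
    (A B : ∀ i : Fin N, Op (blockSize n m i)) :
    blockTensor n m N A * blockTensor n m N B = blockTensor n m N fun i => A i * B i := by
  ext y x
  simp only [Matrix.mul_apply, blockTensor, Matrix.of_apply, ← Finset.prod_mul_distrib]
  exact sum_prod_blocks hm hN fun i u => A i (y ∘ blockQubit n m i) u * B i u (x ∘ blockQubit n m i)

theorem blockTensor_one {n m N : ℕ} (hm : 0 < m) (hN : n ≤ m * N) :
    blockTensor n m N (fun _ => 1) = 1 := by
  ext y x
  rw [Matrix.one_apply, blockTensor, Matrix.of_apply]
  split_ifs with h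
  · subst h
    exact Finset.prod_eq_one fun i _ => Matrix.one_apply_eq _
  · by_contra h0
    refine h (ext_blocks hm hN fun i => ?_)
    by_contra hi
    exact h0 (Finset.prod_eq_zero (Finset.mem_univ i) (Matrix.one_apply_ne hi))

theorem onQubits_blockQubit {n m N : ℕ} (hm : 0 < m) (hN : n ≤ m * N) {i : ℕ} (hi : i < N)
    (U : ∀ j : ℕ, Op (blockSize n m j)) :
    onQubits (blockQubit n m i) (U i) =
      blockTensor n m N fun j => if (j : ℕ) = i then U j else 1 := by
  classical
  ext y x
  rw [onQubits_apply, blockTensor, Matrix.of_apply]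
  split_ifs with h
  · rw [Finset.prod_eq_single ⟨i, hi⟩]
    · simp
    · intro j _ hj
      rw [if_neg fun h => hj (Fin.ext h), Matrix.one_apply, if_pos]
      funext k
      refine h _ fun hk => hj (Fin.ext ?_)
      rw [mem_range_blockQubit hm, blockQubit_div] at hk
      exact hk
    · simp
  · by_contra h0
    refine h fun q hq => ?_
    rw [mem_range_blockQubit hm] at hq
    obtain ⟨⟨j, k⟩, rfl⟩ := (blockQubit_bijective hm hN).2 q
    simp only [blockQubit_div] at hq
    have := mt (Finset.prod_eq_zero (Finset.mem_univ j)) (Ne.symm h0)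
    rw [if_neg hq] at this
    by_contra hk
    exact this (Matrix.one_apply_ne fun h => hk (congrFun h k))

theorem compose_onQubits_blockQubit {n m N : ℕ} (hm : 0 < m) (hN : n ≤ m * N)
    (U : ∀ j : ℕ, Op (blockSize n m j)) {l : List ℕ} (hl : l.Nodup) (hlN : ∀ i ∈ l, i < N) :
    compose (l.map fun i => onQubits (blockQubit n m i) (U i)) =
      blockTensor n m N fun j => if (j : ℕ) ∈ l then U j else 1 := by
  induction l with
  | nil => simpa [compose] using (blockTensor_one hm hN).symm
  | cons a l ih =>
    rw [List.nodup_cons] at hl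
    rw [List.forall_mem_cons] at hlN
    rw [List.map_cons, compose, ih hl.2 hlN.2, onQubits_blockQubit hm hN hlN.1 U,
      blockTensor_mul hm hN]
    congr 1
    funext j
    by_cases hj : (j : ℕ) = a
    · simp [hj, hl.1]
    · simp [hj]

theorem blockTensor_diagonal {n m N : ℕ} (hm : 0 < m) (hN : n ≤ m * N)
    (d : ∀ i : Fin N, Basis (blockSize n m i) → ℂ) :
    blockTensor n m N (fun i => Matrix.diagonal (d i)) =
      Matrix.diagonal fun x => ∏ i : Fin N, d i (x ∘ blockQubit n m i) := by
  ext y x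
  have h := congrFun (congrFun (blockTensor_one hm hN) y) x
  rw [blockTensor, Matrix.of_apply] at h ⊢
  rw [Matrix.diagonal_apply]
  have hd (i : Fin N) : Matrix.diagonal (d i) (y ∘ blockQubit n m i) (x ∘ blockQubit n m i) =
      d i (y ∘ blockQubit n m i) *
        (1 : Op _) (y ∘ blockQubit n m i) (x ∘ blockQubit n m i) := by
    rw [Matrix.diagonal_apply, Matrix.one_apply]
    split_ifs <;> simp
  rw [Finset.prod_congr rfl fun i _ => hd i, Finset.prod_mul_distrib, h, Matrix.one_apply]
  split_ifs <;> simp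

/-! ### The matrix entries of the optimistic QFT -/

/-- The value of the block to the left of block `j` as a fraction of its range (`0` for the first
block). -/
def leftFrac (n m : ℕ) : ℕ → Basis n → ℝ
  | 0, _ => 0
  | j + 1, y => lsbVal (y ∘ blockQubit n m j) / 2 ^ blockSize n m j

/-- The value of the block to the right of block `j` as a fraction of its range. -/
def rightFrac (n m j : ℕ) (x : Basis n) : ℝ :=
  msbVal (x ∘ blockQubit n m (j + 1)) / 2 ^ blockSize n m (j + 1)

theorem leftFrac_nonneg (n m j : ℕ) (y : Basis n) : 0 ≤ leftFrac n m j y := by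
  cases j
  · exact le_rfl
  · rw [leftFrac]
    positivity

theorem leftFrac_le_one (n m j : ℕ) (y : Basis n) : leftFrac n m j y ≤ 1 := by
  cases j
  · exact zero_le_one
  · rw [leftFrac, div_le_one (by positivity)]
    exact_mod_cast (lsbVal_lt _).le

theorem rightFrac_nonneg (n m j : ℕ) (x : Basis n) : 0 ≤ rightFrac n m j x := by
  rw [rightFrac]
  positivity

theorem rightFrac_le_one (n m j : ℕ) (x : Basis n) : rightFrac n m j x ≤ 1 := by
  rw [rightFrac, div_le_one (by positivity)]
  exact_mod_cast (msbVal_lt _).le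

theorem blockSize_eq_zero {n m N i : ℕ} (hN : n ≤ m * N) (hi : N ≤ i) : blockSize n m i = 0 := by
  have := Nat.mul_le_mul_left m hi
  rw [blockSize]
  omega

theorem msbVal_eq_zero {l : ℕ} (hl : l = 0) (x : Basis l) : msbVal x = 0 := by
  subst hl
  simp [msbVal]

theorem rightFrac_eq_zero {n m N j : ℕ} (hN : n ≤ m * N) (hj : N ≤ j + 1) (x : Basis n) :
    rightFrac n m j x = 0 := by
  rw [rightFrac, msbVal_eq_zero (blockSize_eq_zero hN hj), Nat.cast_zero, zero_div]

/-- Each rotation is assigned to its even block, here the left one. The last block has no right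
neighbour, but its `rightFrac` is `0`, so the product may run over all blocks. -/
theorem evenPhases_eq {n m N : ℕ} (hN : n ≤ m * (N + 1)) :
    compose ((evens N).map (blockPhase n m)) = Matrix.diagonal fun x =>
      ∏ i : Fin (N + 1), if (i : ℕ) % 2 = 0 then
        turn (rightFrac n m i x * lsbVal (x ∘ blockQubit n m i) / 2 ^ blockSize n m i) else 1 := by
  rw [List.map_congr_left fun i _ => blockPhase_eq n m i, compose_diagonal]
  congr 1
  funext x
  rw [← List.prod_toFinset _ (nodup_evens N), Fin.prod_univ_castSucc]
  have h0 : rightFrac n m (Fin.last N : Fin (N + 1)) x = 0 := rightFrac_eq_zero hN le_rfl x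
  rw [h0, zero_mul, zero_div, turn_zero, ite_self, mul_one, evens, List.toFinset_filter,
    List.toFinset_range, Finset.prod_filter, Finset.prod_range]
  refine Finset.prod_congr rfl fun i _ => ?_
  simp only [decide_eq_true_eq, Fin.val_castSucc]
  rw [rightFrac, pow_add]
  field_simp

/-- Here the even block is the right one of the pair; block `0` gets a trivial factor from `leftFrac
= 0`. -/
theorem oddPhases_eq (n m N : ℕ) :
    compose ((odds N).map (blockPhase n m)) = Matrix.diagonal fun x =>
      ∏ i : Fin (N + 1), if (i : ℕ) % 2 = 0 then
        turn (leftFrac n m i x * msbVal (x ∘ blockQubit n m i) / 2 ^ blockSize n m i) else 1 := by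
  rw [List.map_congr_left fun i _ => blockPhase_eq n m i, compose_diagonal]
  congr 1
  funext x
  rw [← List.prod_toFinset _ (nodup_odds N), Fin.prod_univ_succ]
  have h0 : leftFrac n m (0 : Fin (N + 1)) x = 0 := rfl
  rw [h0, zero_mul, zero_div, turn_zero, ite_self, one_mul, odds, List.toFinset_filter,
    List.toFinset_range, Finset.prod_filter, Finset.prod_range]
  refine Finset.prod_congr rfl fun i _ => ?_
  simp only [decide_eq_true_eq, Fin.val_succ, leftFrac]
  refine if_congr (by omega) ?_ rfl
  congr 1
  rw [pow_add]
  field_simp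

/-- The entry of the optimistic QFT is a product of entries of block operators. -/
theorem blockEval_oqft_apply {n m N : ℕ} (hm : 0 < m) (hN : n ≤ m * (N + 1))
    (hNm : n ⌈/⌉ m = N + 1) (y x : Basis n) :
    blockEval n m (oqft n m) y x = ∏ i : Fin (N + 1),
      (if (i : ℕ) % 2 = 0 then
        optimisticBlock (blockSize n m i) (leftFrac n m i y) (rightFrac n m i x)
      else qft (blockSize n m i)) (y ∘ blockQubit n m i) (x ∘ blockQubit n m i) := by
  have hE : ∀ i ∈ evens (N + 1), i < N + 1 := fun i hi => (mem_evens.1 hi).1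
  have hO : ∀ i ∈ odds (N + 1), i < N + 1 := fun i hi => (mem_odds.1 hi).1
  have hQE := compose_onQubits_blockQubit hm hN (fun i => qft (blockSize n m i))
    (nodup_evens (N + 1)) hE
  have hQO := compose_onQubits_blockQubit hm hN (fun i => qft (blockSize n m i))
    (nodup_odds (N + 1)) hO
  have hQI := compose_onQubits_blockQubit hm hN (fun i => (qft (blockSize n m i))ᴴ)
    (nodup_evens (N + 1)) hE
  have hP0 := evenPhases_eq hN
  have hP1 := oddPhases_eq n m N
  set E : ∀ i : Fin (N + 1), Op (blockSize n m i) := fun i =>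
    if (i : ℕ) ∈ evens (N + 1) then qft (blockSize n m i) else 1 with hEdef
  set I : ∀ i : Fin (N + 1), Op (blockSize n m i) := fun i =>
    if (i : ℕ) ∈ evens (N + 1) then (qft (blockSize n m i))ᴴ else 1 with hIdef
  set O : ∀ i : Fin (N + 1), Op (blockSize n m i) := fun i =>
    if (i : ℕ) ∈ odds (N + 1) then qft (blockSize n m i) else 1 with hOdef
  set d2 : Basis n → ℂ := fun x => ∏ i : Fin (N + 1), if (i : ℕ) % 2 = 0 then
    turn (rightFrac n m i x * lsbVal (x ∘ blockQubit n m i) / 2 ^ blockSize n m i) else 1 with hd2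
  set d4 : Basis n → ℂ := fun x => ∏ i : Fin (N + 1), if (i : ℕ) % 2 = 0 then
    turn (leftFrac n m i x * msbVal (x ∘ blockQubit n m i) / 2 ^ blockSize n m i) else 1 with hd4
  have hU : blockEval n m (oqft n m) =
      (blockTensor n m (N + 1) E * Matrix.diagonal d4) *
        ((blockTensor n m (N + 1) I * blockTensor n m (N + 1) O) *
          (Matrix.diagonal d2 * blockTensor n m (N + 1) E)) := by
    rw [← hQE, ← hQO, ← hQI, ← hP0, ← hP1]
    simp only [blockEval, oqft, hNm, List.map_cons, List.map_nil, compose, stepEval, List.map_map,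
      List.map_append, compose_append, Function.comp_def, BlockGate.eval, Nat.add_sub_cancel,
      Matrix.one_mul, Matrix.mul_assoc]
  -- The rotations are not tensor products, as they couple blocks. With the odd blocks frozen at
  -- their values in `x` (for `R`) and in `y` (for `L`) they become so, at the price of fixing the
  -- entry `(y, x)`.
  set R : ∀ i : Fin (N + 1), Op (blockSize n m i) := fun i => Matrix.diagonal fun u =>
    if (i : ℕ) % 2 = 0 then turn (rightFrac n m i x * lsbVal u / 2 ^ blockSize n m i) else 1
    with hR
  set L : ∀ i : Fin (N + 1), Op (blockSize n m i) := fun i => Matrix.diagonal fun u =>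
    if (i : ℕ) % 2 = 0 then turn (leftFrac n m i y * msbVal u / 2 ^ blockSize n m i) else 1
    with hL
  -- The first and the last step leave the odd blocks unchanged, which justifies the freezing on
  -- both sides.
  have hEzero (z w : Basis n) (h : blockTensor n m (N + 1) E z w ≠ 0) (j : ℕ) (hj : j < N + 1)
      (hj2 : j % 2 = 1) : z ∘ blockQubit n m j = w ∘ blockQubit n m j := by
    by_contra hne
    rw [blockTensor, Matrix.of_apply] at h
    refine h (Finset.prod_eq_zero (Finset.mem_univ (⟨j, hj⟩ : Fin (N + 1))) ?_)
    have : j ∉ evens (N + 1) := by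
      rw [mem_evens]
      omega
    simp only [hEdef, if_neg this]
    exact Matrix.one_apply_ne hne
  have hrow (z : Basis n) : (blockTensor n m (N + 1) E * Matrix.diagonal d4) y z =
      (blockTensor n m (N + 1) E * blockTensor n m (N + 1) L) y z := by
    rw [hL, blockTensor_diagonal hm hN, Matrix.mul_diagonal, Matrix.mul_diagonal]
    by_cases h : blockTensor n m (N + 1) E y z = 0
    · rw [h, zero_mul, zero_mul]
    · congr 1
      refine Finset.prod_congr rfl fun i _ => ?_
      split_ifs with hi
      · have hi' : leftFrac n m i z = leftFrac n m i y := by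
          obtain ⟨i, hiN⟩ := i
          cases i with
          | zero => rfl
          | succ j =>
            change (j + 1) % 2 = 0 at hi
            change leftFrac n m (j + 1) z = leftFrac n m (j + 1) y
            rw [leftFrac, leftFrac, hEzero y z h j (by omega) (by omega)]
        rw [hi']
      · rfl
  have hcol (w : Basis n) : (Matrix.diagonal d2 * blockTensor n m (N + 1) E) w x =
      (blockTensor n m (N + 1) R * blockTensor n m (N + 1) E) w x := by
    rw [hR, blockTensor_diagonal hm hN, Matrix.diagonal_mul, Matrix.diagonal_mul]
    by_cases h : blockTensor n m (N + 1) E w x = 0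
    · rw [h, mul_zero, mul_zero]
    · congr 1
      refine Finset.prod_congr rfl fun i _ => ?_
      split_ifs with hi
      · have hi' : rightFrac n m i w = rightFrac n m i x := by
          by_cases hiN : (i : ℕ) + 1 < N + 1
          · rw [rightFrac, rightFrac, hEzero w x h (i + 1) hiN (by omega)]
          · rw [rightFrac_eq_zero hN (not_lt.1 hiN), rightFrac_eq_zero hN (not_lt.1 hiN)]
        rw [hi']
      · rfl
  have hU2 : blockEval n m (oqft n m) y x =
      ((blockTensor n m (N + 1) E * blockTensor n m (N + 1) L) *
        ((blockTensor n m (N + 1) I * blockTensor n m (N + 1) O) *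
          (blockTensor n m (N + 1) R * blockTensor n m (N + 1) E))) y x := by
    rw [hU, Matrix.mul_apply, Matrix.mul_apply]
    refine Finset.sum_congr rfl fun z _ => ?_
    rw [hrow, Matrix.mul_apply, Matrix.mul_apply]
    congr 1
    exact Finset.sum_congr rfl fun w _ => by rw [hcol]
  rw [hU2]
  simp only [blockTensor_mul hm hN]
  rw [blockTensor, Matrix.of_apply]
  refine Finset.prod_congr rfl fun i _ => ?_
  by_cases hi : (i : ℕ) % 2 = 0
  · have h1 : (i : ℕ) ∈ evens (N + 1) := mem_evens.2 ⟨i.2, hi⟩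
    have h2 : (i : ℕ) ∉ odds (N + 1) := fun h => by
      have := (mem_odds.1 h).2
      omega
    simp only [hEdef, hIdef, hOdef, hL, hR, if_pos h1, if_neg h2, if_pos hi, Matrix.mul_one,
      optimisticBlock, msbRotation, lsbRotation, Matrix.mul_assoc]
  · have h1 : (i : ℕ) ∉ evens (N + 1) := fun h => hi (mem_evens.1 h).2
    have h2 : (i : ℕ) ∈ odds (N + 1) := mem_odds.2 ⟨i.2, by omega⟩
    simp only [hEdef, hIdef, hOdef, hL, hR, if_pos h2, if_neg h1, if_neg hi, Matrix.mul_one,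
      Matrix.one_mul, Matrix.diagonal_one]

/-! ### Averaging over the even blocks -/

theorem norm_one_sub_prod_le {ι : Type*} (s : Finset ι) (f : ι → ℂ) (h : ∀ i ∈ s, ‖f i‖ ≤ 1) :
    ‖1 - ∏ i ∈ s, f i‖ ≤ ∑ i ∈ s, ‖1 - f i‖ := by
  induction s using Finset.cons_induction with
  | empty => simp
  | cons a s ha ih =>
    rw [Finset.prod_cons, Finset.sum_cons]
    have h1 : 1 - f a * ∏ i ∈ s, f i = (1 - f a) + f a * (1 - ∏ i ∈ s, f i) := by ring
    rw [h1]
    refine (norm_add_le _ _).trans (add_le_add le_rfl ?_)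
    rw [norm_mul]
    exact (mul_le_of_le_one_left (norm_nonneg _) (h a (Finset.mem_cons_self a s))).trans
      (ih fun i hi => h i (Finset.mem_cons_of_mem hi))

theorem sum_extend_extend {k n : ℕ} {f : Fin k → Fin n} (hf : Function.Injective f)
    (F : Basis n → Basis n → ℂ) :
    ∑ y, ∑ x, ∑ u, ∑ v, F (Function.extend f u y) (Function.extend f v x) =
      2 ^ k * 2 ^ k * ∑ y, ∑ x, F y x := by
  have h1 (y : Basis n) :
      ∑ x, ∑ u, ∑ v, F (Function.extend f u y) (Function.extend f v x) =
        2 ^ k * ∑ u, ∑ x, F (Function.extend f u y) x := by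
    rw [Finset.sum_comm, Finset.mul_sum]
    exact Finset.sum_congr rfl fun u _ => sum_sum_extend hf (F (Function.extend f u y))
  simp only [h1]
  rw [← Finset.mul_sum, sum_sum_extend hf fun y => ∑ x, F y x, mul_assoc]

/-- Resampling the qubits `f` of both arguments preserves the total sum up to the factor `2 ^ k * 2
^ k` and fixes `G`, so `r` may be replaced by its average `ρ`. -/
theorem sum_mul_average {k n : ℕ} {f : Fin k → Fin n} (hf : Function.Injective f)
    (r ρ G : Basis n → Basis n → ℂ)
    (hr : ∀ y x, ∑ u, ∑ v, r (Function.extend f u y) (Function.extend f v x) =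
      2 ^ k * 2 ^ k * ρ y x)
    (hG : ∀ y x u v, G (Function.extend f u y) (Function.extend f v x) = G y x) :
    ∑ y, ∑ x, r y x * G y x = ∑ y, ∑ x, ρ y x * G y x := by
  have h := sum_extend_extend hf fun y x => r y x * G y x
  simp only [hG, ← Finset.sum_mul, hr] at h
  simp only [mul_assoc, ← Finset.mul_sum] at h
  exact (mul_left_cancel₀ (pow_ne_zero k two_ne_zero)
    (mul_left_cancel₀ (pow_ne_zero k two_ne_zero) h)).symm

/-- The factors are averaged one block at a time; an averaged factor no longer depends on any block
of `J` and is absorbed into `G`. -/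
theorem sum_prod_average {n m : ℕ} (J : Finset ℕ) (r ρ : ℕ → Basis n → Basis n → ℂ)
    (hr : ∀ i ∈ J, ∀ y x, ∑ u, ∑ v, r i (Function.extend (blockQubit n m i) u y)
      (Function.extend (blockQubit n m i) v x) =
        2 ^ blockSize n m i * 2 ^ blockSize n m i * ρ i y x)
    (hr' : ∀ i ∈ J, ∀ j ∈ J, i ≠ j → ∀ y x u v, r j (Function.extend (blockQubit n m i) u y)
      (Function.extend (blockQubit n m i) v x) = r j y x)
    (hρ : ∀ i ∈ J, ∀ j ∈ J, ∀ y x u v, ρ j (Function.extend (blockQubit n m i) u y)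
      (Function.extend (blockQubit n m i) v x) = ρ j y x)
    (G : Basis n → Basis n → ℂ)
    (hG : ∀ i ∈ J, ∀ y x u v, G (Function.extend (blockQubit n m i) u y)
      (Function.extend (blockQubit n m i) v x) = G y x) :
    ∑ y, ∑ x, (∏ i ∈ J, r i y x) * G y x = ∑ y, ∑ x, (∏ i ∈ J, ρ i y x) * G y x := by
  induction J using Finset.cons_induction generalizing G with
  | empty => simp
  | cons a J ha ih =>
    simp only [Finset.mem_cons, forall_eq_or_imp] at hr hr' hρ hG
    simp only [Finset.prod_cons, mul_assoc]
    rw [sum_mul_average (blockQubit_injective n m a) (r a) (ρ a)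
      (fun y x => (∏ i ∈ J, r i y x) * G y x) hr.1 fun y x u v => ?_]
    · have h := ih hr.2 (fun i hi j hj => (hr'.2 i hi).2 j hj) (fun i hi j hj => (hρ.2 i hi).2 j hj)
        (fun y x => ρ a y x * G y x) fun i hi y x u v => by rw [(hρ.2 i hi).1, hG.2 i hi]
      simp only [mul_left_comm] at h ⊢
      exact h
    · rw [hG.1]
      congr 1
      exact Finset.prod_congr rfl fun j hj =>
        hr'.1.2 j hj (fun h => ha (h ▸ hj)) y x u v

theorem extend_blockQubit_comp {n m i j : ℕ} (h : i ≠ j) (u : Basis (blockSize n m i))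
    (x : Basis n) :
    Function.extend (blockQubit n m i) u x ∘ blockQubit n m j = x ∘ blockQubit n m j :=
  extend_comp_disjoint (blockQubit_disjoint h) u x

/-- The neighbour of an even block is odd, hence untouched by a change on an even block. -/
theorem leftFrac_extend {n m i j : ℕ} (hi : i % 2 = 0) (hj : j % 2 = 0)
    (u : Basis (blockSize n m i)) (y : Basis n) :
    leftFrac n m j (Function.extend (blockQubit n m i) u y) = leftFrac n m j y := by
  cases j with
  | zero => rfl
  | succ j => rw [leftFrac, leftFrac, extend_blockQubit_comp (by omega)]

theorem rightFrac_extend {n m i j : ℕ} (hi : i % 2 = 0) (hj : j % 2 = 0)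
    (u : Basis (blockSize n m i)) (x : Basis n) :
    rightFrac n m j (Function.extend (blockQubit n m i) u x) = rightFrac n m j x := by
  rw [rightFrac, rightFrac, extend_blockQubit_comp (by omega)]

/-- The QFT without the phase rotations between blocks that are not neighbours. -/
def neighbourQft (n m N : ℕ) : Op n := Matrix.of fun y x => ∏ i : Fin (N + 1),
  (if (i : ℕ) % 2 = 0 then
    rotatedQft (blockSize n m i) (leftFrac n m i y) (rightFrac n m i x)
  else qft (blockSize n m i)) (y ∘ blockQubit n m i) (x ∘ blockQubit n m i)

/-- The contribution of block `i` to the overlap of the optimistic QFT and `neighbourQft`. -/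
def localOverlap (n m i : ℕ) (y x : Basis n) : ℂ :=
  2 ^ blockSize n m i *
    (star (rotatedQft (blockSize n m i) (leftFrac n m i y) (rightFrac n m i x)
        (y ∘ blockQubit n m i) (x ∘ blockQubit n m i)) *
      optimisticBlock (blockSize n m i) (leftFrac n m i y) (rightFrac n m i x)
        (y ∘ blockQubit n m i) (x ∘ blockQubit n m i))

theorem sum_localOverlap {n m i : ℕ} (hi : i % 2 = 0) (y x : Basis n) :
    ∑ u, ∑ v, localOverlap n m i (Function.extend (blockQubit n m i) u y)
      (Function.extend (blockQubit n m i) v x) =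
        2 ^ blockSize n m i * 2 ^ blockSize n m i *
          blockOverlap (blockSize n m i) (leftFrac n m i y) (rightFrac n m i x) := by
  simp only [localOverlap, leftFrac_extend hi hi, rightFrac_extend hi hi,
    extend_comp_self (blockQubit_injective n m i), ← Finset.mul_sum]
  rw [blockOverlap, mul_assoc, mul_inv_cancel_left₀ (pow_ne_zero _ two_ne_zero), Finset.sum_comm,
    Matrix.trace]
  simp only [Matrix.diag_apply, Matrix.mul_apply, Matrix.conjTranspose_apply]

/-- Both sides count the basis states. -/
theorem prod_two_pow_blockSize {n m N : ℕ} (hm : 0 < m) (hN : n ≤ m * (N + 1)) :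
    ∏ i : Fin (N + 1), (2 : ℂ) ^ blockSize n m i = 2 ^ n := by
  have h := sum_prod_blocks hm hN fun _ _ => 1
  simpa using h.symm

theorem star_qft_mul_self (l : ℕ) (y x : Basis l) : star (qft l y x) * qft l y x = (2 ^ l)⁻¹ := by
  rw [qft_apply, star_mul', mul_mul_mul_comm, star_turn_mul_self, star_inv_sqrt,
    inv_sqrt_mul_self, mul_one]

theorem star_neighbourQft_mul_oqft {n m N : ℕ} (hm : 0 < m) (hN : n ≤ m * (N + 1))
    (hNm : n ⌈/⌉ m = N + 1) (y x : Basis n) :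
    star (neighbourQft n m N y x) * blockEval n m (oqft n m) y x =
      (2 ^ n)⁻¹ * ∏ i ∈ (Finset.range (N + 1)).filter (· % 2 = 0), localOverlap n m i y x := by
  rw [blockEval_oqft_apply hm hN hNm, neighbourQft, Matrix.of_apply, star_prod,
    ← Finset.prod_mul_distrib, ← prod_two_pow_blockSize hm hN, ← Finset.prod_inv_distrib,
    Finset.prod_filter, Finset.prod_range, ← Finset.prod_mul_distrib]
  refine Finset.prod_congr rfl fun i _ => ?_
  split_ifs
  · rw [localOverlap, inv_mul_cancel_left₀ (pow_ne_zero _ two_ne_zero)]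
  · rw [star_qft_mul_self, mul_one]

/-- After averaging, the overlap is the mean over `y` and `x` of a product of block overlaps of
modulus at most `1`, so the defects of the factors add up. -/
theorem norm_one_sub_overlap_le {n m N : ℕ} (hm : 0 < m) (hN : n ≤ m * (N + 1)) (hN' : m * N < n)
    (hNm : n ⌈/⌉ m = N + 1) :
    ‖1 - (2 ^ n : ℂ)⁻¹ * ∑ y, ∑ x,
      star (neighbourQft n m N y x) * blockEval n m (oqft n m) y x‖ ≤
        (N + 1) * (30 / Real.sqrt (2 ^ m)) := by
  set J := (Finset.range (N + 1)).filter (· % 2 = 0)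
  have hJ : ∀ i ∈ J, i % 2 = 0 := fun i hi => (Finset.mem_filter.1 hi).2
  set ρ : ℕ → Basis n → Basis n → ℂ := fun i y x =>
    blockOverlap (blockSize n m i) (leftFrac n m i y) (rightFrac n m i x) with hρ
  have hsum : ∑ y, ∑ x, star (neighbourQft n m N y x) * blockEval n m (oqft n m) y x =
      (2 ^ n)⁻¹ * ∑ y, ∑ x, ∏ i ∈ J, ρ i y x := by
    have h := sum_prod_average (m := m) J (localOverlap n m) ρ
      (fun i hi y x => sum_localOverlap (hJ i hi) y x) ?_ ?_ (fun _ _ => 1) fun _ _ _ _ _ _ => rfl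
    · simp only [mul_one] at h
      rw [← h]
      simp only [star_neighbourQft_mul_oqft hm hN hNm, Finset.mul_sum]
      rfl
    · intro i hi j hj hij y x u v
      simp only [localOverlap, leftFrac_extend (hJ i hi) (hJ j hj),
        rightFrac_extend (hJ i hi) (hJ j hj), extend_blockQubit_comp hij]
    · intro i hi j hj y x u v
      simp only [hρ, leftFrac_extend (hJ i hi) (hJ j hj), rightFrac_extend (hJ i hi) (hJ j hj)]
  have hcard : (1 : ℂ) = (2 ^ n : ℂ)⁻¹ * ((2 ^ n)⁻¹ * ∑ _y : Basis n, ∑ _x : Basis n, 1) := by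
    have : (2 ^ n : ℂ) ≠ 0 := pow_ne_zero _ two_ne_zero
    simp
  have hb (y x : Basis n) : ‖1 - ∏ i ∈ J, ρ i y x‖ ≤ (N + 1) * (30 / Real.sqrt (2 ^ m)) := by
    refine (norm_one_sub_prod_le J _ fun i _ => norm_blockOverlap_le_one _ _ _).trans ?_
    have hi (i : ℕ) (hi : i ∈ J) : ‖1 - ρ i y x‖ ≤ 30 / Real.sqrt (2 ^ m) := by
      have hiN : i < N + 1 := Finset.mem_range.1 (Finset.mem_filter.1 hi).1
      -- All blocks but the last are full; the last one has overlap exactly `1`.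
      rcases Nat.lt_succ_iff_lt_or_eq.1 hiN with hlt | rfl
      · have hs : blockSize n m i = m := by
          have := Nat.mul_le_mul_left m (Nat.succ_le_of_lt hlt)
          rw [Nat.mul_succ] at this
          rw [blockSize]
          omega
        have h := norm_one_sub_blockOverlap_le (blockSize n m i) (leftFrac_nonneg n m i y)
          (leftFrac_le_one n m i y) (rightFrac_nonneg n m i x) (rightFrac_le_one n m i x)
        simpa only [hρ, hs] using h
      · simp only [hρ]
        rw [rightFrac_eq_zero hN le_rfl, blockOverlap_zero_right, sub_self, norm_zero]
        positivity
    refine (Finset.sum_le_card_nsmul _ _ _ hi).trans ?_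
    rw [nsmul_eq_mul]
    gcongr
    exact_mod_cast (Finset.card_filter_le _ _).trans (Finset.card_range _).le
  rw [hsum]
  nth_rewrite 1 [hcard]
  simp only [← mul_sub, ← Finset.sum_sub_distrib]
  rw [norm_mul, norm_mul, norm_inv, norm_pow, Complex.norm_ofNat, ← mul_assoc, ← mul_inv,
    inv_mul_le_iff₀ (by positivity)]
  have h2 : ∑ _y : Basis n, ∑ _x : Basis n, (N + 1) * (30 / Real.sqrt (2 ^ m)) =
      2 ^ n * 2 ^ n * ((N + 1) * (30 / Real.sqrt (2 ^ m))) := by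
    simp only [Finset.sum_const, Finset.card_univ, Fintype.card_fun, Fintype.card_fin, nsmul_eq_mul]
    push_cast
    ring
  rw [← h2]
  refine (norm_sum_le _ _).trans (Finset.sum_le_sum fun y _ => ?_)
  exact (norm_sum_le _ _).trans (Finset.sum_le_sum fun x _ => hb y x)

/-! ### Phase rotations between distant blocks -/

theorem add_mul_blockSize {n m N i : ℕ} (hN' : m * N < n) (hi : i < N) :
    m * i + blockSize n m i = m * (i + 1) := by
  have := Nat.mul_le_mul_left m (Nat.succ_le_of_lt hi)
  rw [Nat.mul_succ] at this ⊢
  rw [blockSize]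
  omega

theorem add_mul_blockSize_le {n m N : ℕ} (hN' : m * N < n) (i : Fin (N + 1)) :
    m * i + blockSize n m i ≤ n := by
  have := Nat.mul_le_mul_left m (Nat.le_of_lt_succ i.2)
  rw [blockSize]
  omega

/-- As a binary fraction, the input gives qubit `q` the weight `2^(-q-1)`, independent of `n`. -/
theorem msbVal_div_eq {n m N : ℕ} (hm : 0 < m) (hN : n ≤ m * (N + 1)) (hN' : m * N < n)
    (x : Basis n) : (msbVal x : ℝ) / 2 ^ n =
      ∑ j : Fin (N + 1), (msbVal (x ∘ blockQubit n m j) : ℝ) / 2 ^ (m * j + blockSize n m j) := by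
  rw [msbVal, ← (Equiv.ofBijective _ (blockQubit_bijective hm hN)).sum_comp, Fintype.sum_sigma]
  push_cast
  rw [Finset.sum_div]
  refine Finset.sum_congr rfl fun j _ => ?_
  rw [msbVal]
  push_cast
  rw [Finset.sum_div, Finset.sum_div]
  refine Finset.sum_congr rfl fun k _ => ?_
  have hj := add_mul_blockSize_le hN' j
  have hk := k.2
  rw [Equiv.ofBijective_apply]
  simp only [blockQubit_val, Function.comp_apply]
  rw [div_eq_div_iff (by positivity) (by positivity), mul_assoc, mul_assoc, ← pow_add, ← pow_add]
  congr 2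
  omega

theorem lsbVal_eq_sum {n m N : ℕ} (hm : 0 < m) (hN : n ≤ m * (N + 1)) (y : Basis n) :
    (lsbVal y : ℝ) = ∑ i : Fin (N + 1), (lsbVal (y ∘ blockQubit n m i) : ℝ) * 2 ^ (m * i) := by
  rw [lsbVal, ← (Equiv.ofBijective _ (blockQubit_bijective hm hN)).sum_comp, Fintype.sum_sigma]
  push_cast
  refine Finset.sum_congr rfl fun i _ => ?_
  rw [lsbVal]
  push_cast
  rw [Finset.sum_mul]
  refine Finset.sum_congr rfl fun k _ => ?_
  rw [Equiv.ofBijective_apply, blockQubit_val, pow_add, Function.comp_apply]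
  ring

/-- The phase by which block `i` of the output and block `j` of the input contribute to the QFT. -/
def pairPhase (n m : ℕ) (y x : Basis n) (i j : ℕ) : ℝ :=
  lsbVal (y ∘ blockQubit n m i) * 2 ^ (m * i) *
    (msbVal (x ∘ blockQubit n m j) / 2 ^ (m * j + blockSize n m j))

theorem qftPhase_eq {n m N : ℕ} (hm : 0 < m) (hN : n ≤ m * (N + 1)) (hN' : m * N < n)
    (y x : Basis n) : (msbVal x : ℝ) * lsbVal y / 2 ^ n =
      ∑ i : Fin (N + 1), ∑ j : Fin (N + 1), pairPhase n m y x i j := by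
  rw [mul_div_right_comm, msbVal_div_eq hm hN hN', lsbVal_eq_sum hm hN, mul_comm,
    Finset.sum_mul_sum]
  rfl

/-- Block `j` is not the last one, hence full, and its denominator `2 ^ (m * (j + 1))` divides `2 ^
(m * i)`. -/
theorem pairPhase_of_lt {n m N i j : ℕ} (hN' : m * N < n) (hi : i < N + 1) (hj : j < i)
    (y x : Basis n) : ∃ k : ℤ, pairPhase n m y x i j = k := by
  have h1 := add_mul_blockSize hN' (show j < N by omega)
  have h2 : m * (j + 1) ≤ m * i := Nat.mul_le_mul_left m (Nat.succ_le_of_lt hj)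
  refine ⟨lsbVal (y ∘ blockQubit n m i) * msbVal (x ∘ blockQubit n m j) *
    2 ^ (m * i - m * (j + 1)), ?_⟩
  have h3 : (2 : ℝ) ^ (m * i) = 2 ^ (m * i - m * (j + 1)) * 2 ^ (m * (j + 1)) := by
    rw [← pow_add]
    congr 1
    omega
  rw [pairPhase, h1, h3]
  push_cast
  field_simp

theorem pairPhase_self (n m i : ℕ) (y x : Basis n) : pairPhase n m y x i i =
    msbVal (x ∘ blockQubit n m i) * lsbVal (y ∘ blockQubit n m i) / 2 ^ blockSize n m i := by
  rw [pairPhase, pow_add]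
  field_simp

theorem pairPhase_succ {n m N i : ℕ} (hN' : m * N < n) (hi : i < N) (y x : Basis n) :
    pairPhase n m y x i (i + 1) =
      msbVal (x ∘ blockQubit n m (i + 1)) * lsbVal (y ∘ blockQubit n m i) /
        2 ^ (blockSize n m i + blockSize n m (i + 1)) := by
  rw [pairPhase, ← add_mul_blockSize hN' hi, pow_add, pow_add, pow_add]
  field_simp

theorem pairPhase_nonneg (n m i j : ℕ) (y x : Basis n) : 0 ≤ pairPhase n m y x i j := by
  rw [pairPhase]
  positivity

theorem pairPhase_le {n m i j : ℕ} (hij : i + 2 ≤ j) (y x : Basis n) :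
    pairPhase n m y x i j ≤ (1 / 2 ^ m) ^ (j - i - 1) := by
  have h1 : (lsbVal (y ∘ blockQubit n m i) : ℝ) ≤ 2 ^ m := by
    have := (lsbVal_lt (y ∘ blockQubit n m i)).le.trans
      (Nat.pow_le_pow_right two_pos (blockSize_le n m i))
    exact_mod_cast this
  have h2 : (msbVal (x ∘ blockQubit n m j) : ℝ) / 2 ^ (m * j + blockSize n m j) ≤
      1 / 2 ^ (m * j) := by
    rw [div_le_div_iff₀ (by positivity) (by positivity), pow_add, one_mul, mul_comm]
    gcongr
    exact_mod_cast (msbVal_lt _).le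
  have h3 : (1 / 2 ^ m : ℝ) ^ (j - i - 1) = 2 ^ m * 2 ^ (m * i) * (1 / 2 ^ (m * j)) := by
    obtain ⟨d, rfl⟩ := Nat.exists_eq_add_of_le hij
    rw [show i + 2 + d - i - 1 = d + 1 by omega, one_div_pow, ← pow_mul,
      show m * (i + 2 + d) = m + m * i + m * (d + 1) by ring, pow_add, pow_add]
    field_simp
  rw [h3, pairPhase]
  gcongr

theorem sum_pow_le_two_mul {r : ℝ} (h0 : 0 ≤ r) (h1 : r ≤ 1 / 2) (i K : ℕ) :
    ∑ j ∈ Finset.range K, (if i + 2 ≤ j then r ^ (j - i - 1) else 0) ≤ 2 * r := by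
  -- The subtracted term makes the induction close; it uses `r ≤ 1 / 2`.
  have hgeom (K : ℕ) : ∑ k ∈ Finset.range K, r ^ k ≤ 2 - 2 * r ^ K := by
    induction K with
    | zero => simp
    | succ K ih =>
      rw [Finset.sum_range_succ, pow_succ]
      nlinarith [pow_nonneg h0 K]
  have hf : (Finset.range K).filter (fun j => i + 2 ≤ j) = Finset.Ico (i + 2) K := by
    ext j
    simp only [Finset.mem_filter, Finset.mem_range, Finset.mem_Ico]
    omega
  rw [← Finset.sum_filter, hf, Finset.sum_Ico_eq_sum_range]
  have h (k : ℕ) : r ^ (i + 2 + k - i - 1) = r ^ k * r := by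
    rw [← pow_succ]
    congr 1
    omega
  simp only [h, ← Finset.sum_mul]
  have := hgeom (K - (i + 2))
  have := pow_nonneg h0 (K - (i + 2))
  nlinarith

/-- The phases in the QFT between blocks that are not neighbours. -/
def farPhase (n m N : ℕ) (y x : Basis n) : ℝ :=
  ∑ i : Fin (N + 1), ∑ j : Fin (N + 1),
    if (i : ℕ) + 2 ≤ j then pairPhase n m y x i j else 0

theorem farPhase_nonneg (n m N : ℕ) (y x : Basis n) : 0 ≤ farPhase n m N y x :=
  Finset.sum_nonneg fun i _ => Finset.sum_nonneg fun j _ => by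
    split_ifs
    exacts [pairPhase_nonneg _ _ _ _ _ _, le_rfl]

theorem farPhase_le {m : ℕ} (hm : 0 < m) (n N : ℕ) (y x : Basis n) :
    farPhase n m N y x ≤ (N + 1) * (2 * (1 / 2 ^ m)) := by
  have hr : (1 / 2 ^ m : ℝ) ≤ 1 / 2 := by
    gcongr
    exact le_self_pow₀ (by norm_num) hm.ne'
  have h (i : Fin (N + 1)) (_ : i ∈ Finset.univ) :
      ∑ j : Fin (N + 1), (if (i : ℕ) + 2 ≤ j then pairPhase n m y x i j else 0) ≤
        2 * (1 / 2 ^ m) := by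
    refine le_trans ?_ (sum_pow_le_two_mul (by positivity) hr i (N + 1))
    rw [Finset.sum_range]
    refine Finset.sum_le_sum fun j _ => ?_
    split_ifs with hij
    exacts [pairPhase_le hij y x, le_rfl]
  refine (Finset.sum_le_card_nsmul _ _ _ h).trans ?_
  rw [Finset.card_univ, Fintype.card_fin, nsmul_eq_mul]
  push_cast
  exact le_rfl

/-- The phases in the QFT inside the blocks and between neighbouring blocks. -/
def nearPhase (n m N : ℕ) (y x : Basis n) : ℝ :=
  ∑ i : Fin (N + 1), pairPhase n m y x i i + ∑ i : Fin N, pairPhase n m y x i (i + 1)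

theorem turn_qftPhase {n m N : ℕ} (hm : 0 < m) (hN : n ≤ m * (N + 1)) (hN' : m * N < n)
    (y x : Basis n) : turn (msbVal x * lsbVal y / 2 ^ n) =
      turn (nearPhase n m N y x) * turn (farPhase n m N y x) := by
  choose k hk using fun (i j : ℕ) (hi : i < N + 1) (hj : j < i) =>
    pairPhase_of_lt hN' hi hj y x
  rw [← turn_add, qftPhase_eq hm hN hN']
  refine turn_congr (∑ i : Fin (N + 1), ∑ j : Fin (N + 1),
    if h : (j : ℕ) < i then k i j i.2 h else 0) ?_
  have h1 : ∑ i : Fin (N + 1), pairPhase n m y x i i =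
      ∑ i : Fin (N + 1), ∑ j : Fin (N + 1),
        if (i : ℕ) = j then pairPhase n m y x i j else 0 := by
    refine Finset.sum_congr rfl fun i _ => ?_
    simp only [← Fin.ext_iff, Finset.sum_ite_eq, Finset.mem_univ, if_true]
  have h2 : ∑ i : Fin N, pairPhase n m y x i (i + 1) =
      ∑ i : Fin (N + 1), ∑ j : Fin (N + 1),
        if (i : ℕ) + 1 = j then pairPhase n m y x i j else 0 := by
    rw [Fin.sum_univ_castSucc]
    have hlast : ∑ j : Fin (N + 1), (if (Fin.last N : ℕ) + 1 = j then
        pairPhase n m y x (Fin.last N : Fin (N + 1)) j else 0) = 0 :=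
      Finset.sum_eq_zero fun j _ => if_neg (by rw [Fin.val_last]; omega)
    rw [hlast, add_zero]
    refine Finset.sum_congr rfl fun i _ => ?_
    rw [Finset.sum_eq_single i.succ]
    · simp
    · intro j _ hj
      rw [if_neg]
      intro h
      exact hj (Fin.ext h.symm)
    · simp
  rw [nearPhase, farPhase, h1, h2]
  push_cast
  simp only [← Finset.sum_add_distrib]
  refine Finset.sum_congr rfl fun i _ => Finset.sum_congr rfl fun j _ => ?_
  rcases lt_trichotomy (j : ℕ) i with h | h | h
  · rw [dif_pos h, if_neg (by omega), if_neg (by omega), if_neg (by omega), hk i j i.2 h]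
    simp
  · rw [dif_neg (by omega), if_pos h.symm, if_neg (by omega), if_neg (by omega)]
    simp
  · rw [dif_neg (by omega), if_neg (by omega)]
    by_cases h' : (i : ℕ) + 1 = j
    · rw [if_pos h', if_neg (by omega)]
      simp
    · rw [if_neg h', if_pos (by omega)]
      simp

/-- Of two adjacent blocks exactly one is even: the phase of `(i, i + 1)` is the right term of block
`i` for even `i` and the left term of block `i + 1` for odd `i`. -/
theorem sum_neighbour_phases {n m N : ℕ} (hN : n ≤ m * (N + 1)) (hN' : m * N < n) (y x : Basis n) :
    ∑ i : Fin (N + 1), (if (i : ℕ) % 2 = 0 then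
      leftFrac n m i y * msbVal (x ∘ blockQubit n m i) / 2 ^ blockSize n m i +
      rightFrac n m i x * lsbVal (y ∘ blockQubit n m i) / 2 ^ blockSize n m i else 0) =
      ∑ i : Fin N, pairPhase n m y x i (i + 1) := by
  have h (i : Fin (N + 1)) : (if (i : ℕ) % 2 = 0 then
      leftFrac n m i y * msbVal (x ∘ blockQubit n m i) / 2 ^ blockSize n m i +
      rightFrac n m i x * lsbVal (y ∘ blockQubit n m i) / 2 ^ blockSize n m i else 0) =
      (if (i : ℕ) % 2 = 0 then
        leftFrac n m i y * msbVal (x ∘ blockQubit n m i) / 2 ^ blockSize n m i else 0) +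
      (if (i : ℕ) % 2 = 0 then
        rightFrac n m i x * lsbVal (y ∘ blockQubit n m i) / 2 ^ blockSize n m i else 0) := by
    split_ifs <;> simp
  have h0 : leftFrac n m (0 : Fin (N + 1)) y = 0 := rfl
  have h1 : rightFrac n m (Fin.last N : Fin (N + 1)) x = 0 := rightFrac_eq_zero hN le_rfl x
  simp only [h]
  rw [Finset.sum_add_distrib, Fin.sum_univ_succ, h0, Fin.sum_univ_castSucc (n := N) fun i =>
    if (i : ℕ) % 2 = 0 then
      rightFrac n m i x * lsbVal (y ∘ blockQubit n m i) / 2 ^ blockSize n m i else 0, h1]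
  rw [zero_mul, zero_div, ite_self, zero_add, zero_mul, zero_div, ite_self, add_zero,
    ← Finset.sum_add_distrib]
  refine Finset.sum_congr rfl fun i _ => ?_
  rw [pairPhase_succ hN' i.2, pow_add]
  simp only [Fin.val_succ, Fin.val_castSucc, leftFrac, rightFrac]
  by_cases hi : (i : ℕ) % 2 = 0
  · rw [if_neg (by omega), if_pos hi, zero_add]
    field_simp
  · rw [if_pos (by omega), if_neg hi, add_zero]
    field_simp

theorem rotatedQft_apply (l : ℕ) (a b : ℝ) (y x : Basis l) :
    rotatedQft l a b y x = ((Real.sqrt (2 ^ l))⁻¹ : ℂ) *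
      turn (msbVal x * lsbVal y / 2 ^ l + (a * msbVal x / 2 ^ l + b * lsbVal y / 2 ^ l)) := by
  rw [rotatedQft, msbRotation, lsbRotation, Matrix.mul_diagonal, Matrix.diagonal_mul, qft_apply,
    turn_add, turn_add]
  ring

theorem neighbourQft_apply {n m N : ℕ} (hm : 0 < m) (hN : n ≤ m * (N + 1)) (hN' : m * N < n)
    (y x : Basis n) :
    neighbourQft n m N y x = ((Real.sqrt (2 ^ n))⁻¹ : ℂ) * turn (nearPhase n m N y x) := by
  have hc : ∏ i : Fin (N + 1), ((Real.sqrt (2 ^ blockSize n m i))⁻¹ : ℂ) =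
      ((Real.sqrt (2 ^ n))⁻¹ : ℂ) := by
    rw [Finset.prod_inv_distrib, ← Complex.ofReal_prod, ← Real.sqrt_prod _ fun i _ => by positivity]
    have h := prod_two_pow_blockSize hm hN
    have h' : ∏ i : Fin (N + 1), (2 : ℝ) ^ blockSize n m i = 2 ^ n := by exact_mod_cast h
    rw [h']
  rw [neighbourQft, Matrix.of_apply, nearPhase, ← sum_neighbour_phases hN hN', ← hc,
    ← Finset.sum_add_distrib, turn_sum, ← Finset.prod_mul_distrib]
  refine Finset.prod_congr rfl fun i _ => ?_
  rw [pairPhase_self]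
  split_ifs
  · rw [rotatedQft_apply]
  · rw [qft_apply, add_zero]

/-! ### Frobenius distances -/

/-- The square of the Frobenius norm. -/
def frobSq {n : ℕ} (A : Op n) : ℝ := ∑ y, ∑ x, ‖A y x‖ ^ 2

theorem trace_conjTranspose_mul_self_re {n : ℕ} (A : Op n) :
    (Matrix.trace (Aᴴ * A)).re = frobSq A := by
  rw [Matrix.trace, frobSq, Finset.sum_comm, Complex.re_sum]
  refine Finset.sum_congr rfl fun x _ => ?_
  rw [Matrix.diag_apply, Matrix.mul_apply, Complex.re_sum]
  refine Finset.sum_congr rfl fun y _ => ?_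
  rw [Matrix.conjTranspose_apply, Complex.star_def, mul_comm, Complex.mul_conj, Complex.ofReal_re,
    Complex.normSq_eq_norm_sq]

theorem frobSq_unitary {n : ℕ} {U : Op n} (hU : U ∈ Matrix.unitaryGroup (Basis n) ℂ) :
    frobSq U = 2 ^ n := by
  rw [← trace_conjTranspose_mul_self_re, ← Matrix.star_eq_conjTranspose,
    Matrix.mem_unitaryGroup_iff'.1 hU, Matrix.trace_one, Fintype.card_fun, Fintype.card_fin,
    Fintype.card_fin]
  norm_cast

theorem frobSq_sub_eq {n : ℕ} (A B : Op n) :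
    frobSq (A - B) = frobSq A + frobSq B - 2 * (∑ y, ∑ x, star (B y x) * A y x).re := by
  simp only [frobSq, Complex.re_sum, Finset.mul_sum, ← Finset.sum_add_distrib,
    ← Finset.sum_sub_distrib]
  refine Finset.sum_congr rfl fun y _ => Finset.sum_congr rfl fun x _ => ?_
  simp only [Matrix.sub_apply, ← Complex.normSq_eq_norm_sq, Complex.normSq_apply, Complex.sub_re,
    Complex.sub_im, Complex.star_def, Complex.mul_re, Complex.conj_re, Complex.conj_im]
  ring

theorem frobSq_sub_le {n : ℕ} (A B V : Op n) :
    frobSq (A - B) ≤ 2 * frobSq (A - V) + 2 * frobSq (V - B) := by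
  simp only [frobSq, Finset.mul_sum, ← Finset.sum_add_distrib]
  refine Finset.sum_le_sum fun y _ => Finset.sum_le_sum fun x _ => ?_
  simp only [Matrix.sub_apply]
  have h := norm_sub_le_norm_sub_add_norm_sub (A y x) (V y x) (B y x)
  have h0 := norm_nonneg (A y x - B y x)
  nlinarith [sq_nonneg (‖A y x - V y x‖ - ‖V y x - B y x‖)]

theorem norm_inv_sqrt_sq (l : ℕ) : ‖((Real.sqrt (2 ^ l))⁻¹ : ℂ)‖ ^ 2 = (2 ^ l)⁻¹ := by
  rw [norm_inv, Complex.norm_real, Real.norm_of_nonneg (Real.sqrt_nonneg _), inv_pow,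
    Real.sq_sqrt (by positivity)]

theorem sum_sum_inv_two_pow (n : ℕ) (c : ℝ) :
    ∑ _y : Basis n, ∑ _x : Basis n, ((2 ^ n : ℝ)⁻¹ * c) = 2 ^ n * c := by
  simp only [Finset.sum_const, Finset.card_univ, Fintype.card_fun, Fintype.card_fin, nsmul_eq_mul]
  push_cast
  field_simp

/-- All entries have modulus `2^(-n/2)`, so the norm is that of a unitary without unitarity being
needed. -/
theorem frobSq_neighbourQft {n m N : ℕ} (hm : 0 < m) (hN : n ≤ m * (N + 1)) (hN' : m * N < n) :
    frobSq (neighbourQft n m N) = 2 ^ n := by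
  rw [frobSq, ← mul_one (2 ^ n : ℝ), ← sum_sum_inv_two_pow]
  refine Finset.sum_congr rfl fun y _ => Finset.sum_congr rfl fun x _ => ?_
  rw [neighbourQft_apply hm hN hN', norm_mul, norm_turn, mul_one, mul_one, norm_inv_sqrt_sq]

theorem frobSq_neighbourQft_sub_qft_le {n m N : ℕ} (hm : 0 < m) (hN : n ≤ m * (N + 1))
    (hN' : m * N < n) :
    frobSq (neighbourQft n m N - qft n) ≤ 2 ^ n * (8 * Real.pi * ((N + 1) / 2 ^ m)) := by
  rw [frobSq, ← sum_sum_inv_two_pow]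
  refine Finset.sum_le_sum fun y _ => Finset.sum_le_sum fun x _ => ?_
  rw [Matrix.sub_apply, neighbourQft_apply hm hN hN', qft_apply, turn_qftPhase hm hN hN',
    ← mul_assoc, ← mul_one_sub, norm_mul, norm_mul, norm_turn, mul_one, mul_pow, norm_inv_sqrt_sq]
  gcongr
  have h1 := norm_one_sub_turn_le (farPhase n m N y x)
  rw [abs_of_nonneg (farPhase_nonneg n m N y x)] at h1
  have h2 : ‖1 - turn (farPhase n m N y x)‖ ≤ 2 := by
    refine (norm_sub_le _ _).trans ?_
    rw [norm_turn, norm_one]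
    norm_num
  have h3 := farPhase_le hm n N y x
  have h4 := norm_nonneg (1 - turn (farPhase n m N y x))
  -- One factor is bounded by `2`, so that the estimate stays linear in `(N + 1) / 2 ^ m`.
  calc ‖1 - turn (farPhase n m N y x)‖ ^ 2 ≤ 2 * ‖1 - turn (farPhase n m N y x)‖ := by nlinarith
    _ ≤ 2 * (2 * Real.pi * ((N + 1) * (2 * (1 / 2 ^ m)))) := by
      gcongr
      refine h1.trans ?_
      gcongr
    _ = 8 * Real.pi * ((N + 1) / 2 ^ m) := by ring

/-- Both matrices have squared norm `2 ^ n`, so their squared distance is `2 * 2 ^ n` times one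
minus the real part of the normalized overlap. -/
theorem frobSq_oqft_sub_neighbourQft_le {n m N : ℕ} (hm : 0 < m) (hN : n ≤ m * (N + 1))
    (hN' : m * N < n) (hNm : n ⌈/⌉ m = N + 1) :
    frobSq (blockEval n m (oqft n m) - neighbourQft n m N) ≤
      2 ^ n * (60 * ((N + 1) / Real.sqrt (2 ^ m))) := by
  have h := norm_one_sub_overlap_le hm hN hN' hNm
  rw [frobSq_sub_eq, frobSq_unitary (blockEval_mem_unitaryGroup n m),
    frobSq_neighbourQft hm hN hN']
  set T := ∑ y, ∑ x, star (neighbourQft n m N y x) * blockEval n m (oqft n m) y x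
  have h1 : 1 - T.re / 2 ^ n ≤ ‖1 - (2 ^ n : ℂ)⁻¹ * T‖ := by
    refine le_trans (le_of_eq ?_) (Complex.re_le_norm _)
    have : (2 ^ n : ℂ)⁻¹ = ((2 ^ n : ℝ)⁻¹ : ℝ) := by push_cast; rfl
    rw [this, Complex.sub_re, Complex.one_re, Complex.re_ofReal_mul, div_eq_inv_mul]
  have h2 : (2 : ℝ) ^ n + 2 ^ n - 2 * T.re = 2 ^ n * (2 * (1 - T.re / 2 ^ n)) := by
    field_simp
    ring
  rw [h2]
  refine mul_le_mul_of_nonneg_left ?_ (by positivity)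
  calc 2 * (1 - T.re / 2 ^ n) ≤ 2 * ((N + 1) * (30 / Real.sqrt (2 ^ m))) := by
        gcongr
        exact h1.trans h
    _ = 60 * ((N + 1) / Real.sqrt (2 ^ m)) := by ring

theorem exists_ceilDiv {n m : ℕ} (hn : 0 < n) (hm : 0 < m) :
    ∃ N, n ⌈/⌉ m = N + 1 ∧ n ≤ m * (N + 1) ∧ m * N < n := by
  have h : ∀ k, n ⌈/⌉ m ≤ k ↔ n ≤ m * k := fun k => by
    rw [ceilDiv_le_iff_le_mul hm]
  have h0 : n ⌈/⌉ m ≠ 0 := fun h0 => by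
    have := (h 0).1 h0.le
    omega
  obtain ⟨N, hN⟩ := Nat.exists_eq_succ_of_ne_zero h0
  refine ⟨N, hN, (h _).1 hN.le, ?_⟩
  by_contra hlt
  have := (h N).2 (not_lt.1 hlt)
  omega

theorem oqft_error_le {n m : ℕ} (hn : 0 < n) (hm : 0 < m) :
    (Matrix.trace ((blockEval n m (oqft n m) - qft n)ᴴ *
      (blockEval n m (oqft n m) - qft n))).re / 2 ^ n ≤ 180 * (n / Real.sqrt (2 ^ m)) := by
  obtain ⟨N, hNm, hN, hN'⟩ := exists_ceilDiv hn hm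
  rw [trace_conjTranspose_mul_self_re, div_le_iff₀' (by positivity)]
  have h1 := frobSq_sub_le (blockEval n m (oqft n m)) (qft n) (neighbourQft n m N)
  have h2 := frobSq_oqft_sub_neighbourQft_le hm hN hN' hNm
  have h3 := frobSq_neighbourQft_sub_qft_le hm hN hN'
  have hNn : (N + 1 : ℝ) ≤ n := by
    have : N ≤ m * N := Nat.le_mul_of_pos_left N hm
    exact_mod_cast this.trans_lt hN'
  have hs : (1 : ℝ) ≤ Real.sqrt (2 ^ m) := by
    rw [Real.one_le_sqrt]
    exact one_le_pow₀ (by norm_num)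
  have hs' : Real.sqrt (2 ^ m) ≤ (2 : ℝ) ^ m := by
    have := Real.mul_self_sqrt (show (0 : ℝ) ≤ 2 ^ m by positivity)
    nlinarith
  have h4 : ((N + 1) / Real.sqrt (2 ^ m) : ℝ) ≤ n / Real.sqrt (2 ^ m) := by gcongr
  have h5 : ((N + 1) / 2 ^ m : ℝ) ≤ n / Real.sqrt (2 ^ m) := by gcongr
  have hpi := Real.pi_lt_d2
  have hpi0 := Real.pi_pos
  have h6 : (0 : ℝ) ≤ n / Real.sqrt (2 ^ m) := by positivity
  -- The constants add up to `2 * 60 + 2 * 8 * 3.15 = 170.4`.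
  calc frobSq (blockEval n m (oqft n m) - qft n)
      ≤ 2 * (2 ^ n * (60 * ((N + 1) / Real.sqrt (2 ^ m)))) +
        2 * (2 ^ n * (8 * Real.pi * ((N + 1) / 2 ^ m))) := by linarith
    _ ≤ 2 * (2 ^ n * (60 * (n / Real.sqrt (2 ^ m)))) +
        2 * (2 ^ n * (8 * 3.15 * (n / Real.sqrt (2 ^ m)))) := by gcongr
    _ = 2 ^ n * (170.4 * (n / Real.sqrt (2 ^ m))) := by ring
    _ ≤ 2 ^ n * (180 * (n / Real.sqrt (2 ^ m))) := by
      gcongr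
      norm_num

end OptimisticQFT

end

/-! ### Choice of the constants -/

theorem mainTheorem1 :
    ∃ C K : ℝ, 0 < C ∧ 0 < K ∧
      ∀ (n : ℕ) (ε : ℝ), 1 ≤ n → 0 < ε → 2 * ε ≤ (n : ℝ) →
        ∀ m : ℕ, m = ⌈C * Real.log ((n : ℝ) / ε)⌉₊ →
          1 ≤ m ∧
          (m : ℝ) ≤ K * Real.log ((n : ℝ) / ε) ∧
          (∀ s ∈ OptimisticQFT.oqft n m,
            s.Pairwise fun g h => Disjoint g.blocks h.blocks) ∧
          OptimisticQFT.IsOptimistic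
            (OptimisticQFT.blockEval n m (OptimisticQFT.oqft n m)) (OptimisticQFT.qft n) ε ∧
          ∃ cs : List (OptimisticQFT.Circuit n),
            List.Forall₂ (fun c s => OptimisticQFT.Circuit.eval c = OptimisticQFT.stepEval n m s)
              cs (OptimisticQFT.oqft n m) ∧
            (OptimisticQFT.Circuit.depth cs.flatten : ℝ) ≤ K * Real.log ((n : ℝ) / ε) ∧
            OptimisticQFT.Circuit.IsBlockLocal m cs.flatten := by
  -- Write `L = ln (n/ε) ≥ ln 2`. The depth is `5 * 2m = 10m < 400 L + 10`, and `10 ≤ 20 L`.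
  refine ⟨40, 420, by norm_num, by norm_num, fun n ε hn hε hnε m hm => ?_⟩
  have hR : 2 ≤ (n : ℝ) / ε := by rwa [le_div_iff₀ hε]
  have hlog2 := Real.log_two_gt_d9
  have hlog : 0.69 < Real.log ((n : ℝ) / ε) := by
    have := Real.log_le_log (by norm_num) hR
    linarith
  have hmle : 40 * Real.log ((n : ℝ) / ε) ≤ m := hm ▸ Nat.le_ceil _
  have hmlt : (m : ℝ) < 40 * Real.log ((n : ℝ) / ε) + 1 := hm ▸ Nat.ceil_lt_add_one (by linarith)
  have hm1 : 1 ≤ m := by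
    have : (0 : ℝ) < m := by linarith
    exact_mod_cast this
  obtain ⟨cs, hcs, hdepth, hlocal⟩ := OptimisticQFT.exists_circuits n m
    (OptimisticQFT.oqft n m) (OptimisticQFT.oqft_pairwise n m)
  refine ⟨hm1, by linarith, OptimisticQFT.oqft_pairwise n m,
    ⟨OptimisticQFT.blockEval_mem_unitaryGroup n m, OptimisticQFT.qft_mem_unitaryGroup n, ?_⟩,
    cs, hcs, ?_, hlocal⟩
  · refine (OptimisticQFT.oqft_error_le hn hm1).trans ?_
    -- In logarithms this is `26 L ≤ m ln 2`, which follows from `40 ln 2 > 27`. Of the thirteen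
    -- powers, twelve absorb the constant `180 ≤ 2 ^ 12` because `n / ε ≥ 2`, and one gives the
    -- error `ε`.
    have hsqrt : ((n : ℝ) / ε) ^ 13 ≤ Real.sqrt (2 ^ m) := by
      refine Real.le_sqrt_of_sq_le ?_
      rw [← pow_mul, ← Real.log_le_log_iff (by positivity) (by positivity), Real.log_pow,
        Real.log_pow]
      push_cast
      nlinarith
    have hbig : 180 * ((n : ℝ) / ε) ≤ Real.sqrt (2 ^ m) := by
      refine le_trans ?_ hsqrt
      have h12 : (2 : ℝ) ^ 12 ≤ ((n : ℝ) / ε) ^ 12 := by gcongr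
      rw [pow_succ]
      exact mul_le_mul_of_nonneg_right (le_trans (by norm_num) h12) (by positivity)
    rw [← mul_div_assoc, div_le_iff₀ (by positivity)]
    rwa [← mul_div_assoc, div_le_iff₀' hε] at hbig
  · rw [hdepth]
    have : (OptimisticQFT.oqft n m).length = 5 := rfl
    rw [this]
    push_cast
    linarith
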